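/- Let $\Lambda=\{m+n\,e^{i\pi/3}: m,n\in\mathbb Z\}\subset\mathbb C=\mathbb R^2$ be the triangular lattice and let $\Omega$ be a simple closed polygon with vertices in $\Lambda$. An *edge* in $\Omega$ is a segment in the closed region bounded by $\Omega$, not crossing $\Omega$, that joins two distinct points of $\Lambda$ and contains no other point of $\Lambda$. A *triangulation* of $\Omega$ is a set of edges in $\Omega$, any two of which meet at most at lattice points, that covers the polygon $\Omega$ and divides the region into triangular facets containing no lattice points other than their corners (so that all lattice points of the region are vertices). A *flip* transforms one triangulation into another by replacing one diagonal of a convex quadrilateral, whose sides are edges of the triangulation and whose interior meets no edge other than this diagonal, by the other diagonal. A *flip path from $T$ that generates $E$* is a sequence of flips, starting at the triangulation $T$, that leads to a triangulation containing the set of edges $E$; it is *minimum* if no flip path from $T$ that generates $E$ has fewer flips. A *flip plan that generates $E$ from $T$* is a finite partially ordered set $\pi$ of flips whose linear orderings are exactly the flip paths from $T$ that generate $E$ and contain exactly the flips in $\pi$, once each; it is *minimum* if each of its linear orderings is a minimum flip path from $T$ that generates $E$. **Theorem (Minimum Flip Plans Yield Minimum Triangulations).** Suppose that $\Omega$ admits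 an equilateral triangulation $T_0$, i.e. a triangulation all of whose edges, including those along $\Omega$, have the same length. Let $E$ be a finite set of edges in $\Omega$, any two of which meet at most at lattice points. Then there is a unique minimum flip plan $\pi_E$ that generates $E$ from $T_0$, and performing the flips in $\pi_E$ on $T_0$, in any linear ordering of $\pi_E$, yields one and the same triangulation $T$, which is a minimum triangulation of $\Omega$ constrained by $E$: $T$ contains $E$, and the sum of the Euclidean lengths of the edges of $T$ is at most that of any triangulation of $\Omega$ that contains $E$. -/

import Mathlib

noncomputable section

namespace LatticeFlip

/-! ### The triangular lattice and its edges -/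

/-- Integer coordinates of a point of the triangular lattice. -/
abbrev LatticePoint : Type := ℤ × ℤ

/-- The point `m + n * exp (i * π / 3)` of the Euclidean plane, which we take to be `ℂ`; the
range of `pt` is the triangular lattice. -/
def pt (v : LatticePoint) : ℂ :=
  (v.1 : ℂ) + (v.2 : ℂ) * ((1 / 2 : ℂ) + ((Real.sqrt 3 / 2 : ℝ) : ℂ) * Complex.I)

/-- The closed straight-line segment joining the two ends of `e`. -/
def seg (e : Sym2 LatticePoint) : Set ℂ :=
  Sym2.lift ⟨fun a b => segment ℝ (pt a) (pt b), fun a b => segment_symm ℝ (pt a) (pt b)⟩ e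

/-- The segment joining the two ends of `e`, without the ends. -/
def openSeg (e : Sym2 LatticePoint) : Set ℂ :=
  Sym2.lift ⟨fun a b => openSegment ℝ (pt a) (pt b),
    fun a b => openSegment_symm ℝ (pt a) (pt b)⟩ e

/-- The Euclidean length of `e`. -/
def edgeLength (e : Sym2 LatticePoint) : ℝ :=
  Sym2.lift ⟨fun a b => dist (pt a) (pt b), fun a b => dist_comm (pt a) (pt b)⟩ e

/-- The coordinates of the vector from one end of `e` to the other are relatively prime, i.e. the
ends are distinct and there is no lattice point between them. -/
def IsPrimitive (e : Sym2 LatticePoint) : Prop :=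
  ∃ a b : LatticePoint, e = s(a, b) ∧ IsCoprime (b.1 - a.1) (b.2 - a.2)

/-- Two different edges meet at most at lattice points (hence, for primitive edges, at most at
common ends). -/
def NonCrossing (T : Finset (Sym2 LatticePoint)) : Prop :=
  ∀ e ∈ T, ∀ f ∈ T, e ≠ f → Disjoint (openSeg e) (openSeg f)

/-! ### Lattice polygons and their triangulations -/

/-- A simple closed polygon with vertices in the triangular lattice: the vertices are distinct, and
two different sides have no point in common except a common vertex. Sides may contain further
lattice points. -/
structure IsSimpleLatticePolygon {n : ℕ} (Ω : Polygon ℂ n) : Prop where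
  three_le : 3 ≤ n
  vertex_mem : ∀ i, Ω i ∈ Set.range pt
  vertex_injective : Function.Injective Ω.vertices
  side_inter : ∀ i j, i ≠ j → Ω.edgeSet ℝ i ∩ Ω.edgeSet ℝ j ⊆
    ({Ω i, Ω (finRotate n i)} : Set ℂ) ∩ {Ω j, Ω (finRotate n j)}

/-- The closed region bounded by the polygon: the polygon itself and the bounded components of its
complement. -/
def region {n : ℕ} (Ω : Polygon ℂ n) : Set ℂ :=
  Ω.boundary ℝ ∪
    {x | x ∉ Ω.boundary ℝ ∧ Bornology.IsBounded (connectedComponentIn (Ω.boundary ℝ)ᶜ x)}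

/-- `e` is an edge of the lattice point-set of the polygon `Ω`: it is a primitive lattice segment
in the closed region bounded by `Ω` which does not cross the polygon, i.e. it runs either along a
side of the polygon or, except possibly for its ends, in the interior. -/
structure IsEdge {n : ℕ} (Ω : Polygon ℂ n) (e : Sym2 LatticePoint) : Prop where
  primitive : IsPrimitive e
  seg_subset : seg e ⊆ region Ω
  boundary : openSeg e ⊆ Ω.boundary ℝ ∨ Disjoint (openSeg e) (Ω.boundary ℝ)

/-- A set of constraints: edges in `Ω` that pairwise intersect at most at lattice points. -/
structure IsConstraintSet {n : ℕ} (Ω : Polygon ℂ n) (E : Finset (Sym2 LatticePoint)) : Prop where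
  isEdge : ∀ e ∈ E, IsEdge Ω e
  nonCrossing : NonCrossing E

/-- The corners of a triangle. -/
def corners (a b c : LatticePoint) : Set LatticePoint := {a, b, c}

/-- `a`, `b`, `c` span a triangular facet of the graph with edge set `T`: a nondegenerate triangle,
with sides in `T`, which contains no lattice point other than its corners. -/
structure IsFacet (T : Finset (Sym2 LatticePoint)) (a b c : LatticePoint) : Prop where
  mem_ab : s(a, b) ∈ T
  mem_bc : s(b, c) ∈ T
  mem_ca : s(c, a) ∈ T
  not_collinear : ¬ Collinear ℝ (pt '' corners a b c)
  empty : ∀ v : LatticePoint, pt v ∈ convexHull ℝ (pt '' corners a b c) → v ∈ corners a b c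

/-- `T` is the edge set of a (lattice) triangulation of the polygon `Ω`: a straight-line graph on
the set of all the lattice points in the closed region bounded by `Ω`, with non-crossing edges,
containing the polygon, and with triangular interior facets. (As the facets cover the region and
contain no lattice points other than their corners, every lattice point in the region is a vertex
of the graph.) -/
structure IsTriangulation {n : ℕ} (Ω : Polygon ℂ n) (T : Finset (Sym2 LatticePoint)) : Prop where
  isEdge : ∀ e ∈ T, IsEdge Ω e
  nonCrossing : NonCrossing T
  boundary_subset : Ω.boundary ℝ ⊆ ⋃ e ∈ T, seg e
  facets_cover : ∀ x ∈ region Ω, ∃ a b c : LatticePoint,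
    IsFacet T a b c ∧ x ∈ convexHull ℝ (pt '' corners a b c)

/-- The equilateral triangulation: all the edges, including those along the polygon, have the same
length. -/
def IsEquilateralTriangulation {n : ℕ} (Ω : Polygon ℂ n) (T : Finset (Sym2 LatticePoint)) : Prop :=
  IsTriangulation Ω T ∧ ∃ l : ℝ, ∀ e ∈ T, edgeLength e = l

/-- The total edge length. -/
def totalLength (T : Finset (Sym2 LatticePoint)) : ℝ := ∑ e ∈ T, edgeLength e

/-- `T` is a minimum triangulation of `Ω` constrained by `E`. -/
structure IsMinimumTriangulation {n : ℕ} (Ω : Polygon ℂ n) (E T : Finset (Sym2 LatticePoint)) :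
    Prop where
  isTriangulation : IsTriangulation Ω T
  constrained : E ⊆ T
  minimum : ∀ T' : Finset (Sym2 LatticePoint),
    IsTriangulation Ω T' → E ⊆ T' → totalLength T ≤ totalLength T'

/-! ### Diagonal flips and flip paths -/

/-- A diagonal flip, given by the diagonal that it removes and the diagonal that it adds; together
these determine the quadrilateral on which the flip is performed. -/
@[ext]
structure Flip where
  removed : Sym2 LatticePoint
  added : Sym2 LatticePoint

/-- `a b c d` is a (strictly) convex quadrilateral with diagonals `a c` and `b d`: the diagonals
cross at a point inside both, and do not lie on one line. -/
def IsConvexQuad (a b c d : LatticePoint) : Prop :=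
  (openSegment ℝ (pt a) (pt c) ∩ openSegment ℝ (pt b) (pt d)).Nonempty ∧
    ¬ Collinear ℝ ({pt a, pt b, pt c, pt d} : Set ℂ)

/-- The flip `f` transforms the triangulation `T` of `Ω` into the triangulation `T'`: some convex
quadrilateral `a b c d` of `T`, whose interior meets no edge of `T` other than the diagonal `a c`,
has this diagonal replaced by the other one, `b d`. -/
structure IsFlip {n : ℕ} (Ω : Polygon ℂ n) (T : Finset (Sym2 LatticePoint)) (f : Flip)
    (T' : Finset (Sym2 LatticePoint)) : Prop where
  source : IsTriangulation Ω T
  target : IsTriangulation Ω T'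
  eq_insert_erase : T' = insert f.added (T.erase f.removed)
  quad : ∃ a b c d : LatticePoint, f.removed = s(a, c) ∧ f.added = s(b, d) ∧
    IsConvexQuad a b c d ∧
    s(a, b) ∈ T ∧ s(b, c) ∈ T ∧ s(c, d) ∈ T ∧ s(d, a) ∈ T ∧ s(a, c) ∈ T ∧
    ∀ e ∈ T, e ≠ s(a, c) →
      Disjoint (seg e) (interior (convexHull ℝ ({pt a, pt b, pt c, pt d} : Set ℂ)))

/-- `FlipPath Ω T L T'`: performing the flips in the list `L`, in this order, transforms the
triangulation `T` of `Ω` into the triangulation `T'`. -/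
inductive FlipPath {n : ℕ} (Ω : Polygon ℂ n) :
    Finset (Sym2 LatticePoint) → List Flip → Finset (Sym2 LatticePoint) → Prop
  | nil (T : Finset (Sym2 LatticePoint)) : IsTriangulation Ω T → FlipPath Ω T [] T
  | cons (T T' T'' : Finset (Sym2 LatticePoint)) (f : Flip) (L : List Flip) :
      IsFlip Ω T f T' → FlipPath Ω T' L T'' → FlipPath Ω T (f :: L) T''

/-- `L` is a flip path, starting at `T`, that generates the edges in `E`: its target
triangulation contains `E`. -/
def Generates {n : ℕ} (Ω : Polygon ℂ n) (T E : Finset (Sym2 LatticePoint)) (L : List Flip) :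
    Prop :=
  ∃ T' : Finset (Sym2 LatticePoint), FlipPath Ω T L T' ∧ E ⊆ T'

/-! ### Flip plans -/

/-- A finite partially ordered set of flips. -/
@[ext]
structure FlipPoset where
  flips : Finset Flip
  le : Flip → Flip → Prop
  mem_of_le : ∀ f g, le f g → f ∈ flips ∧ g ∈ flips
  le_refl : ∀ f ∈ flips, le f f
  le_trans : ∀ f g h, le f g → le g h → le f h
  le_antisymm : ∀ f g, le f g → le g f → f = g

namespace FlipPoset

/-- `L` contains exactly the flips in `π`, once each. -/
def IsListing (π : FlipPoset) (L : List Flip) : Prop :=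
  L.Nodup ∧ ∀ f, f ∈ L ↔ f ∈ π.flips

/-- `L` is a valid linear ordering of `π`: it lists the flips in `π`, and no flip in `L` is above
a later one. -/
def IsLinearOrdering (π : FlipPoset) (L : List Flip) : Prop :=
  π.IsListing L ∧ L.Pairwise fun f g => ¬ π.le g f

/-- `π` is a flip plan that generates `E` from `T`: its valid linear orderings are exactly the flip
paths that generate `E` from `T` and contain exactly the flips in `π`. -/
def IsFlipPlan {n : ℕ} (Ω : Polygon ℂ n) (T E : Finset (Sym2 LatticePoint)) (π : FlipPoset) :
    Prop :=
  ∀ L : List Flip, π.IsListing L → (π.IsLinearOrdering L ↔ Generates Ω T E L)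

/-- `π` is a minimum flip plan that generates `E` from `T`: every valid linear ordering of it is a
flip path with the least number of flips among all the flip paths that generate `E` from `T`. -/
def IsMinimumFlipPlan {n : ℕ} (Ω : Polygon ℂ n) (T E : Finset (Sym2 LatticePoint))
    (π : FlipPoset) : Prop :=
  π.IsFlipPlan Ω T E ∧ ∀ L : List Flip, π.IsLinearOrdering L →
    ∀ L' : List Flip, Generates Ω T E L' → L.length ≤ L'.length

/-- Applying `π` to `T` yields `T'`: performing its flips on `T`, in any valid linear ordering,
transforms `T` into `T'`. -/
def Yields {n : ℕ} (Ω : Polygon ℂ n) (π : FlipPoset) (T T' : Finset (Sym2 LatticePoint)) : Prop :=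
  ∀ L : List Flip, π.IsLinearOrdering L → FlipPath Ω T L T'

end FlipPoset

end LatticeFlip

end

open LatticeFlip

/-!
A flip always takes place in a parallelogram made of two lattice triangles of minimal area, and one
diagonal of such a parallelogram is longer than the other. The longer diagonal determines the
shorter one. Hence, a lengthening flip is determined by the edge that it adds, and generating that
edge from unit edges requires the removed diagonal and the sides of the parallelogram, which in turn
require further lengthening flips. Every flip path from the unit triangulation `T₀` that generates
`E` contains all the flips required by `E` in this sense.

Conversely, by Heron's formula, the longest edge of any triangulation lies opposite obtuse angles
and can be flipped to a shorter one unless all edges have unit length, so every triangulation is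
reached from `T₀` by lengthening flips only. Leaving out those that `E` does not require yields a
path that still generates `E` and ends in a triangulation that is not longer, while the end depends
only on the set of flips performed. Two lattice triangulations of the same polygon have the same
edge midpoints (the half lattice points of the region), which makes the edge through a given
midpoint well-defined along a flip path.
-/

namespace LatticeFlip

variable {n : ℕ} {Ω : Polygon ℂ n} {T T₀ T' E : Finset (Sym2 LatticePoint)}

/-! ### Coordinates and orientation -/

/-- The first coordinate with respect to the basis `1`, `exp (i * π / 3)`. -/
noncomputable def coordX : ℂ →L[ℝ] ℝ := Complex.reCLM - (1 / Real.sqrt 3) • Complex.imCLM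

/-- The second coordinate with respect to the basis `1`, `exp (i * π / 3)`. -/
noncomputable def coordY : ℂ →L[ℝ] ℝ := (2 / Real.sqrt 3) • Complex.imCLM

lemma pt_re (v : LatticePoint) : (pt v).re = v.1 + v.2 / 2 := by
  simp [pt, div_eq_mul_inv]

lemma pt_im (v : LatticePoint) : (pt v).im = v.2 * (Real.sqrt 3 / 2) := by
  simp [pt]

@[simp] lemma coordX_pt (v : LatticePoint) : coordX (pt v) = v.1 := by
  simp only [coordX, sub_apply, smul_apply, Complex.reCLM_apply, Complex.imCLM_apply, pt_re, pt_im,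
    smul_eq_mul]
  field_simp
  ring

@[simp] lemma coordY_pt (v : LatticePoint) : coordY (pt v) = v.2 := by
  simp only [coordY, smul_apply, Complex.imCLM_apply, pt_im, smul_eq_mul]
  field_simp

lemma ext_coord {z w : ℂ} (hX : coordX z = coordX w) (hY : coordY z = coordY w) : z = w := by
  have him : z.im = w.im := by
    simp only [coordY, smul_apply, Complex.imCLM_apply, smul_eq_mul] at hY
    exact mul_left_cancel₀ (by positivity) hY
  have hre : z.re = w.re := by
    simp only [coordX, sub_apply, smul_apply,
      Complex.imCLM_apply, Complex.reCLM_apply, smul_eq_mul, him] at hX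
    linarith
  exact Complex.ext hre him

lemma pt_injective : Function.Injective pt := by
  intro v w h
  have hX := congrArg coordX h
  have hY := congrArg coordY h
  simp only [coordX_pt, coordY_pt, Int.cast_inj] at hX hY
  exact Prod.ext hX hY

lemma pt_add_zsmul_sub (a b : LatticePoint) (k : ℤ) :
    pt (a + k • (b - a)) = AffineMap.lineMap (pt a) (pt b) (k : ℝ) := by
  apply ext_coord <;>
    simp only [AffineMap.lineMap_apply, vsub_eq_sub, vadd_eq_add, map_add, map_sub, map_smul,
      coordX_pt, coordY_pt, Prod.fst_add, Prod.snd_add, Prod.smul_fst, Prod.smul_snd,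
      Prod.fst_sub, Prod.snd_sub, smul_eq_mul] <;>
    push_cast <;> ring

/-- Twice the signed area of a lattice triangle, in units of the fundamental parallelogram. -/
def area (a b c : LatticePoint) : ℤ := (b.1 - a.1) * (c.2 - a.2) - (b.2 - a.2) * (c.1 - a.1)

/-- The extension of `area a b` to the plane as an affine function: it is positive to the left of
the line from `a` to `b` and negative to the right of it. -/
noncomputable def orient (a b : LatticePoint) (z : ℂ) : ℝ :=
  (b.1 - a.1) * (coordY z - a.2) - (b.2 - a.2) * (coordX z - a.1)

section Orientation

variable {a b c v w : LatticePoint} {z z' : ℂ}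

@[simp] lemma orient_pt (a b c : LatticePoint) : orient a b (pt c) = area a b c := by
  simp [orient, area]

lemma orient_comb (a b : LatticePoint) (z z' : ℂ) {s t : ℝ} (h : s + t = 1) :
    orient a b (s • z + t • z') = s * orient a b z + t * orient a b z' := by
  obtain rfl : s = 1 - t := by linarith
  simp only [orient, map_add, map_smul, smul_eq_mul]
  ring

lemma continuous_orient (a b : LatticePoint) : Continuous (orient a b) := by
  unfold orient
  fun_prop

lemma orient_swap (a b : LatticePoint) (z : ℂ) : orient b a z = -orient a b z := by
  simp only [orient]
  ring

lemma orient_sum (a b c : LatticePoint) (z : ℂ) :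
    orient a b z + orient b c z + orient c a z = area a b c := by
  simp only [orient, area]
  push_cast
  ring

lemma area_sum (a b c v : LatticePoint) : area a b v + area b c v + area c a v = area a b c := by
  simp only [area]
  ring

lemma area_rotate (a b c : LatticePoint) : area b c a = area a b c := by
  simp only [area]
  ring

lemma area_rotate' (a b c : LatticePoint) : area c a b = area a b c := by
  simp only [area]
  ring

lemma area_swap (a b c : LatticePoint) : area b a c = -area a b c := by
  simp only [area]
  ring

lemma area_swap' (a b c : LatticePoint) : area a c b = -area a b c := by
  simp only [area]
  ring

@[simp] lemma area_left (a b : LatticePoint) : area a b a = 0 := by simp [area]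

@[simp] lemma area_right (a b : LatticePoint) : area a b b = 0 := by
  simp only [area]
  ring

@[simp] lemma area_same (a b : LatticePoint) : area a a b = 0 := by simp [area]

lemma area_add_zsmul_sub (a b v p q : LatticePoint) (k : ℤ) :
    area a b (v + k • (q - p)) = area a b v + k * (area a b q - area a b p) := by
  simp only [area, Prod.fst_add, Prod.snd_add, Prod.smul_fst, Prod.smul_snd, Prod.fst_sub,
    Prod.snd_sub, smul_eq_mul]
  ring

lemma eq_of_orient (h : area a b c ≠ 0) (hab : orient a b z = orient a b z')
    (hbc : orient b c z = orient b c z') : z = z' := by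
  have hne : (area a b c : ℝ) ≠ 0 := by exact_mod_cast h
  have harea : (area a b c : ℝ) = (b.1 - a.1) * (c.2 - a.2) - (b.2 - a.2) * (c.1 - a.1) := by
    simp [area]
  simp only [orient] at hab hbc
  apply ext_coord <;> apply mul_left_cancel₀ hne <;> rw [harea]
  · linear_combination ((c.1 : ℝ) - b.1) * hab - ((b.1 : ℝ) - a.1) * hbc
  · linear_combination ((c.2 : ℝ) - b.2) * hab - ((b.2 : ℝ) - a.2) * hbc

lemma eq_of_area (h : area a b c ≠ 0) (hab : area a b v = area a b w)
    (hbc : area b c v = area b c w) : v = w :=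
  pt_injective (eq_of_orient h (by simpa using hab) (by simpa using hbc))

lemma exists_lineMap_of_orient_eq_zero (hab : a ≠ b) (hz : orient a b z = 0) :
    ∃ r : ℝ, z = AffineMap.lineMap (pt a) (pt b) r := by
  set x : ℝ := b.1 - a.1 with hx
  set y : ℝ := b.2 - a.2 with hy
  have hne : x ^ 2 + y ^ 2 ≠ 0 := by
    intro h
    have hx0 : x = 0 := by nlinarith [sq_nonneg x, sq_nonneg y]
    have hy0 : y = 0 := by nlinarith [sq_nonneg x, sq_nonneg y]
    refine hab (Prod.ext ?_ ?_)
    · exact_mod_cast (sub_eq_zero.1 (hx ▸ hx0)).symm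
    · exact_mod_cast (sub_eq_zero.1 (hy ▸ hy0)).symm
  rw [orient, ← hx, ← hy] at hz
  refine ⟨(x * (coordX z - a.1) + y * (coordY z - a.2)) / (x ^ 2 + y ^ 2), ?_⟩
  apply ext_coord <;>
    simp only [AffineMap.lineMap_apply, vsub_eq_sub, vadd_eq_add, map_add, map_smul, map_sub,
      smul_eq_mul, coordX_pt, coordY_pt, ← hx, ← hy] <;>
    field_simp
  · linear_combination -y * hz
  · linear_combination x * hz

lemma collinear_of_orient_eq_zero (hab : a ≠ b) {S : Set ℂ} (hS : ∀ z ∈ S, orient a b z = 0) :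
    Collinear ℝ S := by
  rw [collinear_iff_exists_forall_eq_smul_vadd]
  refine ⟨pt a, pt b - pt a, fun z hz => ?_⟩
  exact exists_lineMap_of_orient_eq_zero hab (hS z hz)

lemma area_eq_zero_of_collinear (h : Collinear ℝ {pt a, pt b, pt c}) : area a b c = 0 := by
  obtain ⟨u, hu⟩ := (collinear_iff_of_mem (p₀ := pt a) (by simp)).1 h
  obtain ⟨r, hr⟩ := hu (pt b) (by simp)
  obtain ⟨s, hs⟩ := hu (pt c) (by simp)
  have hbX := congrArg coordX hr
  have hbY := congrArg coordY hr
  have hcX := congrArg coordX hs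
  have hcY := congrArg coordY hs
  simp only [vadd_eq_add, map_add, map_smul, smul_eq_mul, coordX_pt, coordY_pt]
    at hbX hbY hcX hcY
  have : (area a b c : ℝ) = 0 := by
    simp only [area, Int.cast_sub, Int.cast_mul, hbX, hbY, hcX, hcY]
    ring
  exact_mod_cast this

end Orientation

/-! ### Segments and primitive edges -/

section Segments

variable {a b c d p q : LatticePoint} {e : Sym2 LatticePoint} {z : ℂ}

@[simp] lemma seg_mk (a b : LatticePoint) : seg s(a, b) = segment ℝ (pt a) (pt b) := rfl

@[simp] lemma openSeg_mk (a b : LatticePoint) :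
    openSeg s(a, b) = openSegment ℝ (pt a) (pt b) := rfl

lemma openSeg_subset_seg (e : Sym2 LatticePoint) : openSeg e ⊆ seg e := by
  induction e with | h a b => exact openSegment_subset_segment _ _ _

lemma mem_seg_iff : z ∈ seg s(a, b) ↔ z = pt a ∨ z = pt b ∨ z ∈ openSeg s(a, b) := by
  rw [seg_mk, openSeg_mk, ← insert_endpoints_openSegment, Set.mem_insert_iff, Set.mem_insert_iff]

lemma exists_comb_of_mem_openSeg (hz : z ∈ openSeg s(p, q)) :
    ∃ s t : ℝ, 0 < s ∧ 0 < t ∧ s + t = 1 ∧ z = s • pt p + t • pt q ∧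
      ∀ a b, orient a b z = s * area a b p + t * area a b q := by
  obtain ⟨s, t, hs, ht, hst, rfl⟩ := hz
  exact ⟨s, t, hs, ht, hst, rfl, fun a b => by rw [orient_comb _ _ _ _ hst, orient_pt, orient_pt]⟩

lemma orient_eq_zero_of_mem_seg (hz : z ∈ seg s(a, b)) : orient a b z = 0 := by
  obtain ⟨s, t, -, -, hst, rfl⟩ := hz
  rw [orient_comb _ _ _ _ hst, orient_pt, orient_pt, area_left, area_right]
  simp

/-- The midpoint of an edge. -/
noncomputable def mid (e : Sym2 LatticePoint) : ℂ :=
  Sym2.lift ⟨fun a b => midpoint ℝ (pt a) (pt b), fun a b => midpoint_comm (pt a) (pt b)⟩ e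

@[simp] lemma mid_mk (a b : LatticePoint) : mid s(a, b) = midpoint ℝ (pt a) (pt b) := rfl

lemma mid_mem (e : Sym2 LatticePoint) : mid e ∈ openSeg e := by
  induction e with | h a b =>
  rw [mid_mk, openSeg_mk, midpoint_eq_smul_add, smul_add]
  exact ⟨⅟2, ⅟2, by norm_num, by norm_num, by norm_num, rfl⟩

lemma mid_eq_mid_iff : mid s(a, b) = mid s(c, d) ↔ a + b = c + d := by
  have cancel (u v : ℂ) : (⅟2 : ℝ) • u = (⅟2 : ℝ) • v ↔ u = v :=
    (smul_right_injective ℂ (by norm_num : (⅟2 : ℝ) ≠ 0)).eq_iff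
  rw [mid_mk, mid_mk, midpoint_eq_smul_add, midpoint_eq_smul_add, cancel]
  constructor
  · intro h
    have hX := congrArg coordX h
    have hY := congrArg coordY h
    simp only [map_add, coordX_pt, coordY_pt] at hX hY
    exact Prod.ext (by exact_mod_cast hX) (by exact_mod_cast hY)
  · intro h
    apply ext_coord <;> simp only [map_add, coordX_pt, coordY_pt]
    · exact_mod_cast congrArg Prod.fst h
    · exact_mod_cast congrArg Prod.snd h

lemma orient_mid (a b p q : LatticePoint) :
    orient a b (mid s(p, q)) = (area a b p + area a b q) / 2 := by
  rw [mid_mk, midpoint_eq_smul_add, smul_add, orient_comb _ _ _ _ (by norm_num), orient_pt,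
    orient_pt, invOf_eq_inv]
  ring

lemma isPrimitive_mk : IsPrimitive s(a, b) ↔ IsCoprime (b.1 - a.1) (b.2 - a.2) := by
  constructor
  · rintro ⟨c, d, h, hc⟩
    rcases Sym2.eq_iff.1 h with ⟨rfl, rfl⟩ | ⟨rfl, rfl⟩
    · exact hc
    · simpa using hc.neg_neg
  · exact fun h => ⟨a, b, rfl, h⟩

lemma isPrimitive_of_area_eq_one (h : area a b c = 1) : IsPrimitive s(a, b) := by
  rw [isPrimitive_mk]
  refine ⟨c.2 - a.2, -(c.1 - a.1), ?_⟩
  rw [← h, area]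
  ring

lemma IsPrimitive.ne (h : IsPrimitive s(a, b)) : a ≠ b := by
  rintro rfl
  simp [isPrimitive_mk, isCoprime_zero_left] at h

lemma IsPrimitive.exists_eq_add_zsmul (h : IsPrimitive s(a, b)) (hpq : area a b p = area a b q) :
    ∃ k : ℤ, q = p + k • (b - a) := by
  obtain ⟨x, y, hxy⟩ := isPrimitive_mk.1 h
  simp only [area] at hpq
  refine ⟨x * (q.1 - p.1) + y * (q.2 - p.2), Prod.ext ?_ ?_⟩ <;>
    simp only [Prod.fst_add, Prod.snd_add, Prod.smul_fst, Prod.smul_snd, Prod.fst_sub,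
      Prod.snd_sub, smul_eq_mul]
  · linear_combination -(q.1 - p.1) * hxy + y * hpq
  · linear_combination -(q.2 - p.2) * hxy - x * hpq

lemma pt_notMem_openSeg (he : IsPrimitive e) (p : LatticePoint) : pt p ∉ openSeg e := by
  induction e with | h a b =>
  intro hp
  have harea : area a b p = 0 := by
    have := orient_eq_zero_of_mem_seg (openSeg_subset_seg _ hp)
    rw [orient_pt] at this
    exact_mod_cast this
  obtain ⟨k, rfl⟩ := he.exists_eq_add_zsmul (p := a) (q := p) (by rw [area_left, harea])
  rw [openSeg_mk, openSegment_eq_image_lineMap, pt_add_zsmul_sub] at hp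
  obtain ⟨t, ⟨ht0, ht1⟩, ht⟩ := hp
  obtain rfl : t = k := AffineMap.lineMap_injective ℝ (pt_injective.ne he.ne) ht
  norm_cast at ht0 ht1
  omega

/-- The endpoints of `cd` are `a + i (b - a)` and `a + j (b - a)` for integers `i` and `j`, which
differ by `1` because `cd` is primitive and are `0` and `1` because the segments meet. -/
lemma IsPrimitive.eq_of_parallel (hab : IsPrimitive s(a, b)) (hcd : IsPrimitive s(c, d))
    (hpar : area a b c = area a b d) (hz : z ∈ openSeg s(a, b)) (hz' : z ∈ openSeg s(c, d)) :
    s(a, b) = s(c, d) := by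
  have hc : area a b c = 0 := by
    obtain ⟨s, t, -, -, hst, -, hcomb⟩ := exists_comb_of_mem_openSeg hz'
    have h0 := orient_eq_zero_of_mem_seg (openSeg_subset_seg _ hz)
    rw [hcomb, ← hpar, ← add_mul, hst, one_mul] at h0
    exact_mod_cast h0
  obtain ⟨i, rfl⟩ := hab.exists_eq_add_zsmul (p := a) (q := c) (by rw [area_left, hc])
  obtain ⟨j, rfl⟩ := hab.exists_eq_add_zsmul (p := a) (q := d) (by rw [area_left, ← hpar, hc])
  rw [openSeg_mk, openSegment_eq_image_lineMap] at hz hz'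
  obtain ⟨t, ⟨ht0, ht1⟩, rfl⟩ := hz
  obtain ⟨t', ⟨ht0', ht1'⟩, ht'⟩ := hz'
  have ht : t = i + t' * (j - i) := by
    refine AffineMap.lineMap_injective ℝ (pt_injective.ne hab.ne) (ht'.symm.trans ?_)
    rw [pt_add_zsmul_sub, pt_add_zsmul_sub]
    simp only [AffineMap.lineMap_apply, vsub_eq_sub, vadd_eq_add]
    module
  have hunit : IsUnit (j - i) := by
    refine (isPrimitive_mk.1 hcd).isUnit_of_dvd' ⟨b.1 - a.1, ?_⟩ ⟨b.2 - a.2, ?_⟩ <;>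
      simp only [Prod.fst_add, Prod.snd_add, Prod.smul_fst, Prod.smul_snd, Prod.fst_sub,
        Prod.snd_sub, smul_eq_mul] <;> ring
  rcases Int.isUnit_iff.1 hunit with h | h
  · obtain rfl : j = i + 1 := by omega
    obtain rfl : i = 0 := by
      push_cast at ht
      have h1 : (i : ℝ) < 1 := by linarith
      have h2 : (-1 : ℝ) < i := by linarith
      norm_cast at h1 h2
      omega
    simp
  · obtain rfl : j = i - 1 := by omega
    obtain rfl : i = 1 := by
      push_cast at ht
      have h1 : (i : ℝ) < 2 := by linarith
      have h2 : (0 : ℝ) < i := by linarith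
      norm_cast at h1 h2
      omega
    simp [Sym2.eq_swap]

end Segments

/-! ### Unimodular triangles -/

section Triangles

/-- The closed triangle on the left of `ab`, `bc` and `ca`. -/
def triSet (a b c : LatticePoint) : Set ℂ :=
  {z | 0 ≤ orient a b z ∧ 0 ≤ orient b c z ∧ 0 ≤ orient c a z}

variable {a b c v : LatticePoint} {z : ℂ}

lemma triSet_rotate (a b c : LatticePoint) : triSet b c a = triSet a b c := by
  ext z
  simp only [triSet, Set.mem_ofPred_eq]
  tauto

lemma isClosed_triSet (a b c : LatticePoint) : IsClosed (triSet a b c) :=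
  (isClosed_le continuous_const (continuous_orient a b)).inter
    ((isClosed_le continuous_const (continuous_orient b c)).inter
      (isClosed_le continuous_const (continuous_orient c a)))

lemma convex_triSet (a b c : LatticePoint) : Convex ℝ (triSet a b c) := by
  rintro x ⟨hx, hx', hx''⟩ y ⟨hy, hy', hy''⟩ s t hs ht hst
  simp only [triSet, Set.mem_ofPred_eq, orient_comb _ _ _ _ hst]
  exact ⟨by positivity, by positivity, by positivity⟩

lemma eq_barycentric (h : area a b c ≠ 0) (z : ℂ) :
    z = (orient b c z / area a b c) • pt a + (orient c a z / area a b c) • pt b +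
      (orient a b z / area a b c) • pt c := by
  have hne : (area a b c : ℝ) ≠ 0 := by exact_mod_cast h
  have harea : (area a b c : ℝ) = (b.1 - a.1) * (c.2 - a.2) - (b.2 - a.2) * (c.1 - a.1) := by
    simp [area]
  apply ext_coord <;> apply mul_left_cancel₀ hne <;>
    simp only [map_add, map_smul, smul_eq_mul, coordX_pt, coordY_pt] <;> field_simp <;>
    rw [harea] <;> simp only [orient] <;> ring

lemma convexHull_eq_triSet (h : 0 < area a b c) :
    convexHull ℝ {pt a, pt b, pt c} = triSet a b c := by
  have hpos : (0 : ℝ) < area a b c := by exact_mod_cast h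
  apply Set.Subset.antisymm
  · apply convexHull_min _ (convex_triSet a b c)
    rintro z (rfl | rfl | rfl) <;> simp [triSet, area_rotate, h.le]
  · rintro z ⟨hab, hbc, hca⟩
    have hsum := orient_sum a b c z
    rw [eq_barycentric h.ne' z]
    have hmem := (convex_convexHull ℝ {pt a, pt b, pt c}).sum_mem (t := Finset.univ)
      (w := ![orient b c z / area a b c, orient c a z / area a b c, orient a b z / area a b c])
      (z := ![pt a, pt b, pt c])
      (by
        intro i _
        fin_cases i
        exacts [div_nonneg hbc hpos.le, div_nonneg hca hpos.le, div_nonneg hab hpos.le])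
      (by
        simp only [Fin.sum_univ_three, Matrix.cons_val]
        field_simp
        linarith)
      (by intro i _; apply subset_convexHull; fin_cases i <;> simp)
    simpa [Fin.sum_univ_succ, add_assoc] using hmem

lemma triSet_mem_nhds (hab : 0 < orient a b z) (hbc : 0 < orient b c z)
    (hca : 0 < orient c a z) : triSet a b c ∈ nhds z := by
  filter_upwards [(continuous_orient a b).continuousAt.eventually (lt_mem_nhds hab),
    (continuous_orient b c).continuousAt.eventually (lt_mem_nhds hbc),
    (continuous_orient c a).continuousAt.eventually (lt_mem_nhds hca)] with w h₁ h₂ h₃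
  exact ⟨h₁.le, h₂.le, h₃.le⟩

lemma mem_openSeg_of_orient (hab : orient a b z = 0) (hbc : 0 < orient b c z)
    (hca : 0 < orient c a z) : z ∈ openSeg s(a, b) := by
  have hsum := orient_sum a b c z
  have hpos : (0 : ℝ) < area a b c := by linarith
  have hne : area a b c ≠ 0 := by exact_mod_cast hpos.ne'
  refine ⟨orient b c z / area a b c, orient c a z / area a b c, by positivity, by positivity,
    by field_simp; linarith, ?_⟩
  conv_rhs => rw [eq_barycentric hne z, hab, zero_div, zero_smul, add_zero]

lemma mem_seg_of_orient (h : 0 < area a b c) (hab : orient a b z = 0)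
    (hbc : 0 ≤ orient b c z) (hca : 0 ≤ orient c a z) : z ∈ seg s(a, b) := by
  have hsum := orient_sum a b c z
  have hpos : (0 : ℝ) < area a b c := by exact_mod_cast h
  refine ⟨orient b c z / area a b c, orient c a z / area a b c, div_nonneg hbc hpos.le,
    div_nonneg hca hpos.le, by field_simp; linarith, ?_⟩
  conv_rhs => rw [eq_barycentric h.ne' z, hab, zero_div, zero_smul, add_zero]

lemma frontier_triSet_subset (h : 0 < area a b c) :
    frontier (triSet a b c) ⊆ seg s(a, b) ∪ seg s(b, c) ∪ seg s(c, a) := by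
  intro z hz
  rw [(isClosed_triSet a b c).frontier_eq] at hz
  obtain ⟨⟨hab, hbc, hca⟩, hint⟩ := hz
  rcases hab.eq_or_lt with hab' | hab'
  · exact .inl (.inl (mem_seg_of_orient h hab'.symm hbc hca))
  rcases hbc.eq_or_lt with hbc' | hbc'
  · exact .inl (.inr (mem_seg_of_orient (by rwa [area_rotate]) hbc'.symm hca hab))
  rcases hca.eq_or_lt with hca' | hca'
  · exact .inr (mem_seg_of_orient (by rwa [area_rotate']) hca'.symm hab hbc)
  · exact absurd (mem_interior_iff_mem_nhds.2 (triSet_mem_nhds hab' hbc' hca')) hint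

lemma eq_corner_of_mem_triSet (h : area a b c = 1) (hv : pt v ∈ triSet a b c) :
    v = a ∨ v = b ∨ v = c := by
  obtain ⟨hab, hbc, hca⟩ := hv
  simp only [orient_pt] at hab hbc hca
  norm_cast at hab hbc hca
  have hne : area a b c ≠ 0 := by omega
  have hbca : area b c a = 1 := by rw [area_rotate, h]
  have hsum := area_sum a b c v
  have hcases : (area a b v = 0 ∧ area b c v = 1) ∨ (area a b v = 0 ∧ area b c v = 0) ∨
    (area a b v = 1 ∧ area b c v = 0) := by omega
  rcases hcases with ⟨h₁, h₂⟩ | ⟨h₁, h₂⟩ | ⟨h₁, h₂⟩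
  · left; apply eq_of_area hne <;> simp [*]
  · right; left; apply eq_of_area hne <;> simp [*]
  · right; right; apply eq_of_area hne <;> simp [*]

/-- Twice the midpoint `p + q` has nonnegative integral barycentric coordinates of sum `2`, so it
is twice a corner, which is impossible for a primitive edge, or the sum of two corners. -/
lemma mid_eq_of_mem_triSet (h : area a b c = 1) {e : Sym2 LatticePoint} (he : IsPrimitive e)
    (hm : mid e ∈ triSet a b c) :
    mid e = mid s(a, b) ∨ mid e = mid s(b, c) ∨ mid e = mid s(c, a) := by
  induction e with | h p q =>
  have hbca : area b c a = 1 := by rw [area_rotate, h]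
  have of_coords {v w : LatticePoint} (h₁ : area a b p + area a b q = area a b v + area a b w)
      (h₂ : area b c p + area b c q = area b c v + area b c w) : mid s(p, q) = mid s(v, w) := by
    apply eq_of_orient (by omega : area a b c ≠ 0) <;> rw [orient_mid, orient_mid] <;> congr 1
    · exact_mod_cast h₁
    · exact_mod_cast h₂
  have not_corner {v : LatticePoint} (h₁ : area a b p + area a b q = area a b v + area a b v)
      (h₂ : area b c p + area b c q = area b c v + area b c v) : False := by
    have hv := mid_mem s(p, q)
    rw [of_coords h₁ h₂, mid_mk, midpoint_self] at hv
    exact pt_notMem_openSeg he v hv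
  have nonneg {x y : LatticePoint} (hxy : 0 ≤ orient x y (mid s(p, q))) :
      0 ≤ area x y p + area x y q := by
    rw [orient_mid] at hxy
    have : (0 : ℝ) ≤ area x y p + area x y q := by linarith
    exact_mod_cast this
  have hab := nonneg hm.1
  have hbc := nonneg hm.2.1
  have hca := nonneg hm.2.2
  have hp := area_sum a b c p
  have hq := area_sum a b c q
  have hcases : (area a b p + area a b q = 0 ∧ area b c p + area b c q = 0) ∨
      (area a b p + area a b q = 0 ∧ area b c p + area b c q = 1) ∨
      (area a b p + area a b q = 0 ∧ area b c p + area b c q = 2) ∨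
      (area a b p + area a b q = 1 ∧ area b c p + area b c q = 0) ∨
      (area a b p + area a b q = 1 ∧ area b c p + area b c q = 1) ∨
      (area a b p + area a b q = 2 ∧ area b c p + area b c q = 0) := by omega
  rcases hcases with ⟨h₁, h₂⟩ | ⟨h₁, h₂⟩ | ⟨h₁, h₂⟩ | ⟨h₁, h₂⟩ | ⟨h₁, h₂⟩ | ⟨h₁, h₂⟩
  · exact (not_corner (v := b) (by simp [h₁]) (by simp [h₂])).elim
  · exact .inl (of_coords (by simp [h₁]) (by simp [h₂, hbca]))
  · exact (not_corner (v := a) (by simp [h₁]) (by simp [h₂, hbca])).elim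
  · exact .inr (.inl (of_coords (by simp [h₁, h]) (by simp [h₂])))
  · exact .inr (.inr (of_coords (by simp [h₁, h]) (by simp [h₂, hbca])))
  · exact (not_corner (v := c) (by simp [h₁, h]) (by simp [h₂])).elim

lemma IsPrimitive.exists_area_eq_one (h : IsPrimitive s(a, b)) : ∃ v, area a b v = 1 := by
  obtain ⟨x, y, hxy⟩ := isPrimitive_mk.1 h
  refine ⟨(a.1 - y, a.2 + x), ?_⟩
  simp only [area]
  linear_combination hxy

/-- On the lattice line at height `1` over `ab`, consecutive points differ by `b - a`; if the area
is at least `2`, one of them lies in the triangle without being a corner. -/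
lemma area_eq_one_of_empty (hp : IsPrimitive s(a, b)) (h : 0 < area a b c)
    (hempty : ∀ v, pt v ∈ triSet a b c → v = a ∨ v = b ∨ v = c) : area a b c = 1 := by
  by_contra hne
  obtain ⟨u, hu⟩ := hp.exists_area_eq_one
  obtain ⟨v, hab, hca⟩ : ∃ v, area a b v = 1 ∧ area c a v = area c a u % area a b c := by
    refine ⟨u + (-(area c a u / area a b c)) • (b - a), ?_, ?_⟩ <;> rw [area_add_zsmul_sub]
    · simp [hu]
    · rw [area_rotate' a b c, area_right, Int.emod_def]
      ring
  have hca_nonneg : 0 ≤ area c a v := hca ▸ Int.emod_nonneg _ h.ne'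
  have hca_lt : area c a v < area a b c := hca ▸ Int.emod_lt_of_pos _ h
  have hbc : 0 ≤ area b c v := by linarith [area_sum a b c v]
  rcases hempty v ⟨by simp [hab], by simpa using hbc, by simpa using hca_nonneg⟩
    with rfl | rfl | rfl
  · simp at hab
  · simp at hab
  · exact hne hab

end Triangles

/-! ### Drawings and their tiles -/

/-- Drawings: finite sets of primitive edges which pairwise do not cross. They need not cover
anything, so that the notion applies to constraint sets and to triangulations alike. -/
structure IsDrawing (T : Finset (Sym2 LatticePoint)) : Prop where
  nonCrossing : NonCrossing T
  primitive : ∀ e ∈ T, IsPrimitive e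

/-- Tiles: the facets of a drawing `T`, encoded as positively oriented unimodular triangles with
sides in `T`. By `IsTile.isFacet` and `area_eq_one_of_empty` these are the triangles in the sense
of `IsFacet`, listed counterclockwise. -/
structure IsTile (T : Finset (Sym2 LatticePoint)) (a b c : LatticePoint) : Prop where
  mem_ab : s(a, b) ∈ T
  mem_bc : s(b, c) ∈ T
  mem_ca : s(c, a) ∈ T
  area_eq : area a b c = 1

lemma inter_frontier_nonempty {X : Type*} [TopologicalSpace X] {C K : Set X}
    (hC : IsPreconnected C) (hK : (C ∩ K).Nonempty) (hKc : (C ∩ Kᶜ).Nonempty) :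
    (C ∩ frontier K).Nonempty := by
  by_contra hdisj
  rw [Set.not_nonempty_iff_eq_empty, ← Set.disjoint_iff_inter_eq_empty] at hdisj
  obtain ⟨x, hx, hxK⟩ := hK
  obtain ⟨y, hy, hyK⟩ := hKc
  have hx' : x ∈ interior K := by
    by_contra h
    exact hdisj.notMem_of_mem_left hx ⟨subset_closure hxK, h⟩
  have hy' : y ∈ (closure K)ᶜ := fun h =>
    hdisj.notMem_of_mem_left hy ⟨h, fun h' => hyK (interior_subset h')⟩
  have hcover : C ⊆ interior K ∪ (closure K)ᶜ := fun z hz => by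
    by_contra h
    rw [Set.mem_union, not_or, Set.mem_compl_iff, not_not] at h
    exact hdisj.notMem_of_mem_left hz ⟨h.2, h.1⟩
  obtain ⟨w, -, hw, hw'⟩ := hC (interior K) (closure K)ᶜ isOpen_interior
    isClosed_closure.isOpen_compl hcover ⟨x, hx, hx'⟩ ⟨y, hy, hy'⟩
  exact hw' (interior_subset_closure hw)

section Drawings

variable {a b c c' d p q : LatticePoint} {e f : Sym2 LatticePoint} {z : ℂ}

lemma IsTile.rotate (h : IsTile T a b c) : IsTile T b c a :=
  ⟨h.mem_bc, h.mem_ca, h.mem_ab, by rw [area_rotate, h.area_eq]⟩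

namespace IsDrawing

lemma eq_of_mem (hT : IsDrawing T) (he : e ∈ T) (hf : f ∈ T)
    (hze : z ∈ openSeg e) (hzf : z ∈ openSeg f) : e = f := by
  by_contra h
  exact Set.disjoint_left.1 (hT.nonCrossing e he f hf h) hze hzf

lemma eq_of_mid_eq (hT : IsDrawing T) (he : e ∈ T) (hf : f ∈ T) (h : mid e = mid f) : e = f :=
  hT.eq_of_mem he hf (mid_mem e) (h ▸ mid_mem f)

lemma eq_of_mem_seg (hT : IsDrawing T) (he : e ∈ T) (hf : f ∈ T) (hze : z ∈ openSeg e)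
    (hzf : z ∈ seg f) : e = f := by
  induction f with | h p q =>
  rcases mem_seg_iff.1 hzf with rfl | rfl | hzf
  · exact absurd hze (pt_notMem_openSeg (hT.primitive e he) p)
  · exact absurd hze (pt_notMem_openSeg (hT.primitive e he) q)
  · exact hT.eq_of_mem he hf hze hzf

/-- An edge leaving the tile would meet its boundary, and hence be one of its sides. -/
lemma eq_corner_of_mem_interior (hT : IsDrawing T) (h : IsTile T a b c) (he : s(p, q) ∈ T)
    (hz : z ∈ openSeg s(p, q)) (hab : 0 < orient a b z) (hbc : 0 < orient b c z)
    (hca : 0 < orient c a z) : p = a ∨ p = b ∨ p = c := by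
  apply eq_corner_of_mem_triSet h.area_eq
  by_contra hp
  obtain ⟨y, hy, hyf⟩ := inter_frontier_nonempty (K := triSet a b c)
    (convex_segment (𝕜 := ℝ) z (pt p)).isPreconnected
    ⟨z, left_mem_segment .., hab.le, hbc.le, hca.le⟩ ⟨pt p, right_mem_segment .., hp⟩
  have hyp : y ≠ pt p := by
    rintro rfl
    exact hp ((isClosed_triSet a b c).frontier_subset hyf)
  have hys : y ∈ openSeg s(p, q) := by
    obtain ⟨s', t', hs', ht', hst', rfl⟩ := hz
    obtain ⟨s, t, hs, ht, hst, rfl⟩ := hy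
    have hs0 : 0 < s := hs.lt_of_ne' (by rintro rfl; simp_all)
    exact ⟨s * s' + t, s * t', by positivity, by positivity,
      by linear_combination s * hst' + hst, by module⟩
  have not_side {u v : LatticePoint} (huv : s(u, v) ∈ T) (hzuv : 0 < orient u v z) :
      y ∉ seg s(u, v) := fun hyuv => by
    rw [hT.eq_of_mem_seg he huv hys hyuv] at hz
    exact hzuv.ne' (orient_eq_zero_of_mem_seg (openSeg_subset_seg _ hz))
  rcases frontier_triSet_subset (by rw [h.area_eq]; norm_num) hyf with (hy | hy) | hy
  · exact not_side h.mem_ab hab hy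
  · exact not_side h.mem_bc hbc hy
  · exact not_side h.mem_ca hca hy

lemma notMem_interior (hT : IsDrawing T) (h : IsTile T a b c) (he : e ∈ T) (hz : z ∈ openSeg e)
    (hab : 0 < orient a b z) (hbc : 0 < orient b c z) : ¬ 0 < orient c a z := by
  intro hca
  induction e with | h p q =>
  have hp := hT.eq_corner_of_mem_interior h he hz hab hbc hca
  have hq := hT.eq_corner_of_mem_interior h (p := q) (q := p) (by rwa [Sym2.eq_swap])
    (by rwa [Sym2.eq_swap]) hab hbc hca
  obtain ⟨s, t, -, -, -, -, hcomb⟩ := exists_comb_of_mem_openSeg hz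
  rw [hcomb] at hab hbc hca
  have hne := (hT.primitive _ he).ne
  rcases hp with rfl | rfl | rfl <;> rcases hq with rfl | rfl | rfl <;> simp at hab hbc hca hne

/-- Two tiles on the same side of `ab` have third corners `c` and `c + k (b - a)`; if `0 < k`,
the edge from `a` to the latter enters the tile `abc`. -/
lemma tile_unique (hT : IsDrawing T) (h : IsTile T a b c) (h' : IsTile T a b c') : c = c' := by
  obtain ⟨k, rfl⟩ := (hT.primitive _ h.mem_ab).exists_eq_add_zsmul
    (h.area_eq.trans h'.area_eq.symm)
  wlog hk : 0 < k generalizing c k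
  · rcases (not_lt.1 hk).eq_or_lt with rfl | hk
    · simp
    · have := this (c := c + k • (b - a)) h' (-k) (by simpa using h) (by omega)
      simpa using this.symm
  have hbca : area b c a = 1 := by rw [area_rotate, h.area_eq]
  have : (0 : ℝ) < k := by exact_mod_cast hk
  set ε : ℝ := 1 / (2 + k) with hε
  have hε0 : 0 < ε := by positivity
  have hεk : ε * k = 1 - 2 * ε := by rw [hε]; field_simp; ring
  have hεk0 : 0 < ε * k := by positivity
  have hst : (1 - ε) + ε = 1 := by ring
  refine absurd ?_ (hT.notMem_interior h h'.mem_ca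
    (z := (1 - ε) • pt a + ε • pt (c + k • (b - a))) ?_ ?_ ?_)
  · simp only [orient_comb _ _ _ _ hst, orient_pt, area_left, area_right, area_add_zsmul_sub,
      area_rotate' a b c, h.area_eq]
    push_cast
    linarith
  · rw [Sym2.eq_swap]
    exact ⟨1 - ε, ε, by linarith, hε0, hst, rfl⟩
  · simp only [orient_comb _ _ _ _ hst, orient_pt, area_left, h'.area_eq]
    push_cast
    linarith
  · simp only [orient_comb _ _ _ _ hst, orient_pt, area_right, area_left, area_add_zsmul_sub, hbca]
    push_cast
    linarith

lemma eq_diagonal (hT : IsDrawing T) (h : IsTile T a b c) (h' : IsTile T a c d) (he : e ∈ T)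
    (hz : z ∈ openSeg e) (hab : 0 < orient a b z) (hbc : 0 < orient b c z)
    (hcd : 0 < orient c d z) (hda : 0 < orient d a z) : e = s(a, c) := by
  rcases lt_trichotomy (orient a c z) 0 with hac | hac | hac
  · exact absurd (by rw [orient_swap]; linarith) (hT.notMem_interior h he hz hab hbc)
  · exact hT.eq_of_mem he (Sym2.eq_swap ▸ h.mem_ca) hz (mem_openSeg_of_orient hac hcd hda)
  · exact absurd hda (hT.notMem_interior h' he hz hac hcd)

end IsDrawing

end Drawings

/-! ### The region bounded by a polygon -/

section Region

variable {a b c : LatticePoint}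

lemma isClosed_boundary (Ω : Polygon ℂ n) : IsClosed (Ω.boundary ℝ) := by
  refine isClosed_iUnion_of_finite fun i => ?_
  rw [Polygon.edgeSet, affineSegment_eq_segment, ← convexHull_pair]
  exact (Set.toFinite _).isClosed_convexHull ℝ

lemma isOpen_region_diff_boundary (Ω : Polygon ℂ n) : IsOpen (region Ω \ Ω.boundary ℝ) := by
  rw [isOpen_iff_mem_nhds]
  rintro x ⟨hx, hxb⟩
  have hbdd := (hx.resolve_left hxb).2
  have hopen := (isClosed_boundary Ω).isOpen_compl.connectedComponentIn (x := x)
  filter_upwards [hopen.mem_nhds (mem_connectedComponentIn hxb)] with y hy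
  have hyb := connectedComponentIn_subset _ _ hy
  exact ⟨.inr ⟨hyb, connectedComponentIn_eq hy ▸ hbdd⟩, hyb⟩

lemma subset_region_of_frontier {K : Set ℂ} (hK : Bornology.IsBounded K)
    (hf : frontier K ⊆ region Ω) : K ⊆ region Ω := by
  intro x hx
  by_cases hxb : x ∈ Ω.boundary ℝ
  · exact .inl hxb
  refine .inr ⟨hxb, ?_⟩
  by_cases hsub : connectedComponentIn (Ω.boundary ℝ)ᶜ x ⊆ K
  · exact hK.subset hsub
  obtain ⟨w, hw, hwf⟩ := inter_frontier_nonempty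
    (isPreconnected_connectedComponentIn (F := (Ω.boundary ℝ)ᶜ) (x := x))
    ⟨x, mem_connectedComponentIn hxb, hx⟩ (Set.not_subset.1 hsub)
  rw [connectedComponentIn_eq hw]
  exact ((hf hwf).resolve_left (connectedComponentIn_subset _ _ hw)).2

lemma triSet_subset_region (h : 0 < area a b c) (hab : seg s(a, b) ⊆ region Ω)
    (hbc : seg s(b, c) ⊆ region Ω) (hca : seg s(c, a) ⊆ region Ω) :
    triSet a b c ⊆ region Ω := by
  apply subset_region_of_frontier
  · rw [← convexHull_eq_triSet h]
    exact ((Set.toFinite _).isCompact_convexHull ℝ).isBounded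
  · exact (frontier_triSet_subset h).trans (Set.union_subset (Set.union_subset hab hbc) hca)

end Region

/-! ### Triangulations -/

section Triangulations

variable {a b c : LatticePoint} {e f : Sym2 LatticePoint} {z : ℂ}

lemma image_corners (a b c : LatticePoint) : pt '' corners a b c = {pt a, pt b, pt c} := by
  simp [corners, Set.image_insert_eq]

lemma IsFacet.swap (h : IsFacet T a b c) : IsFacet T b a c := by
  have hcorners : corners b a c = corners a b c := Set.insert_comm _ _ _
  exact ⟨Sym2.eq_swap ▸ h.mem_ab, Sym2.eq_swap ▸ h.mem_ca, Sym2.eq_swap ▸ h.mem_bc,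
    hcorners ▸ h.not_collinear, hcorners ▸ h.empty⟩

lemma IsFacet.isTile (h : IsFacet T a b c) (hab : IsPrimitive s(a, b)) (hpos : 0 < area a b c) :
    IsTile T a b c := by
  refine ⟨h.mem_ab, h.mem_bc, h.mem_ca, area_eq_one_of_empty hab hpos fun v hv => ?_⟩
  exact h.empty v (by rwa [image_corners, convexHull_eq_triSet hpos])

lemma IsFacet.area_ne_zero (h : IsFacet T a b c) (hab : a ≠ b) : area a b c ≠ 0 := by
  intro h0
  refine h.not_collinear (collinear_of_orient_eq_zero hab ?_)
  rw [image_corners]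
  rintro z (rfl | rfl | rfl) <;> simp [h0]

lemma IsTile.isFacet (h : IsTile T a b c) : IsFacet T a b c := by
  have hpos : 0 < area a b c := by simp [h.area_eq]
  refine ⟨h.mem_ab, h.mem_bc, h.mem_ca, ?_, fun v hv => ?_⟩ <;> rw [image_corners] at *
  · exact fun hcol => hpos.ne' (area_eq_zero_of_collinear hcol)
  · rw [convexHull_eq_triSet hpos] at hv
    exact eq_corner_of_mem_triSet h.area_eq hv

lemma finite_tiles (T : Finset (Sym2 LatticePoint)) :
    {t : LatticePoint × LatticePoint × LatticePoint | IsTile T t.1 t.2.1 t.2.2}.Finite := by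
  set V := T.biUnion Sym2.toFinset
  refine (V ×ˢ V ×ˢ V).finite_toSet.subset ?_
  rintro ⟨a, b, c⟩ h
  simp only [Finset.coe_product, Set.mem_prod, Finset.mem_coe]
  exact ⟨Finset.mem_biUnion.2 ⟨_, h.mem_ab, by simp⟩, Finset.mem_biUnion.2 ⟨_, h.mem_ab, by simp⟩,
    Finset.mem_biUnion.2 ⟨_, h.mem_bc, by simp⟩⟩

lemma eventually_mem_triSet_imp (T : Finset (Sym2 LatticePoint)) (m : ℂ) :
    ∀ᶠ z in nhds m, ∀ a b c, IsTile T a b c → z ∈ triSet a b c → m ∈ triSet a b c := by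
  have hall := (Filter.eventually_all_finite (finite_tiles T) (l := nhds m)
    (p := fun t z => z ∈ triSet t.1 t.2.1 t.2.2 → m ∈ triSet t.1 t.2.1 t.2.2)).2 fun t _ => by
      by_cases hm : m ∈ triSet t.1 t.2.1 t.2.2
      · exact .of_forall fun _ _ => hm
      · filter_upwards [(isClosed_triSet _ _ _).isOpen_compl.mem_nhds hm] with z hz hz'
        exact absurd hz' hz
  filter_upwards [hall] with z hz a b c h
  exact hz (a, b, c) h

lemma IsPrimitive.frequently_orient_pos (h : IsPrimitive s(a, b)) (hz : orient a b z = 0) :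
    ∃ᶠ w in nhds z, 0 < orient a b w := by
  obtain ⟨u, hu⟩ := h.exists_area_eq_one
  have horient (t : ℝ) : orient a b ((1 - t) • z + t • pt u) = t := by
    rw [orient_comb _ _ _ _ (by ring), hz, orient_pt, hu]
    simp
  have hcont : Continuous fun t : ℝ => (1 - t) • z + t • pt u := by fun_prop
  have htendsto := (hcont.tendsto 0).mono_left (nhdsWithin_le_nhds (s := Set.Ioi 0))
  rw [sub_zero, one_smul, zero_smul, add_zero] at htendsto
  refine htendsto.frequently (Filter.Eventually.frequently ?_)
  filter_upwards [self_mem_nhdsWithin] with t ht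
  rwa [horient]

lemma IsPrimitive.infinite_openSeg (he : IsPrimitive e) : (openSeg e).Infinite := by
  induction e with | h a b =>
  rw [openSeg_mk, openSegment_eq_image_lineMap]
  exact (Set.Ioo_infinite zero_lt_one).image
    (AffineMap.lineMap_injective ℝ (pt_injective.ne he.ne)).injOn

lemma IsPrimitive.eq_of_infinite_inter (he : IsPrimitive e) (hf : IsPrimitive f)
    (h : (openSeg e ∩ seg f).Infinite) : e = f := by
  induction e with | h a b =>
  induction f with | h c d =>
  have hopen : (openSeg s(a, b) ∩ openSeg s(c, d)).Infinite := by
    refine (h.sdiff (Set.toFinite {pt c, pt d})).mono ?_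
    rintro z ⟨⟨hze, hzf⟩, hzcd⟩
    rw [mem_seg_iff] at hzf
    simp only [Set.mem_insert_iff, Set.mem_singleton_iff, not_or] at hzcd
    exact ⟨hze, by tauto⟩
  obtain ⟨z, ⟨hze, hzf⟩, w, ⟨hwe, hwf⟩, hzw⟩ := hopen.nontrivial
  refine he.eq_of_parallel hf ?_ hze hzf
  obtain ⟨s, t, -, -, hst, rfl, hz⟩ := exists_comb_of_mem_openSeg hzf
  obtain ⟨s', t', -, -, hst', rfl, hw⟩ := exists_comb_of_mem_openSeg hwf
  have hz0 := orient_eq_zero_of_mem_seg (openSeg_subset_seg _ hze)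
  have hw0 := orient_eq_zero_of_mem_seg (openSeg_subset_seg _ hwe)
  rw [hz] at hz0
  rw [hw] at hw0
  obtain rfl : s = 1 - t := by linarith
  obtain rfl : s' = 1 - t' := by linarith
  have hprod : (t - t') * ((area a b c : ℝ) - area a b d) = 0 := by linear_combination hw0 - hz0
  rcases mul_eq_zero.1 hprod with ht | hpar
  · obtain rfl : t = t' := by linarith
    exact absurd rfl hzw
  · exact_mod_cast sub_eq_zero.1 hpar

namespace IsTriangulation

lemma isDrawing (hT : IsTriangulation Ω T) : IsDrawing T :=
  ⟨hT.nonCrossing, fun e he => (hT.isEdge e he).primitive⟩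

lemma cover (hT : IsTriangulation Ω T) (hz : z ∈ region Ω) :
    ∃ a b c, IsTile T a b c ∧ z ∈ triSet a b c := by
  obtain ⟨a, b, c, hF, hz⟩ := hT.facets_cover z hz
  rw [image_corners] at hz
  have hab := hT.isDrawing.primitive _ hF.mem_ab
  rcases (hF.area_ne_zero hab.ne).lt_or_gt with h | h
  · have h' : 0 < area b a c := by rw [area_swap]; omega
    rw [Set.insert_comm, convexHull_eq_triSet h'] at hz
    exact ⟨b, a, c, hF.swap.isTile (Sym2.eq_swap ▸ hab) h', hz⟩
  · exact ⟨a, b, c, hF.isTile hab h, by rwa [← convexHull_eq_triSet h]⟩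

lemma exists_mid_eq (hT : IsTriangulation Ω T) (he : IsEdge Ω e) :
    ∃ a b c, IsTile T a b c ∧ mid e = mid s(a, b) := by
  obtain ⟨a, b, c, h, hm⟩ := hT.cover (he.seg_subset (openSeg_subset_seg _ (mid_mem e)))
  rcases mid_eq_of_mem_triSet h.area_eq he.primitive hm with hab | hbc | hca
  · exact ⟨_, _, _, h, hab⟩
  · exact ⟨_, _, _, h.rotate, hbc⟩
  · exact ⟨_, _, _, h.rotate.rotate, hca⟩

lemma mem_of_subset_boundary (hT : IsTriangulation Ω T) (he : IsPrimitive e)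
    (hb : openSeg e ⊆ Ω.boundary ℝ) : e ∈ T := by
  have hcover : openSeg e ⊆ ⋃ f ∈ T, openSeg e ∩ seg f := by
    intro z hz
    obtain ⟨f, hf, hzf⟩ := Set.mem_iUnion₂.1 (hT.boundary_subset (hb hz))
    exact Set.mem_iUnion₂.2 ⟨f, hf, hz, hzf⟩
  obtain ⟨f, hf, hinf⟩ : ∃ f ∈ T, (openSeg e ∩ seg f).Infinite := by
    by_contra! hfin
    exact he.infinite_openSeg ((Set.Finite.biUnion T.finite_toSet hfin).subset hcover)
  rwa [he.eq_of_infinite_inter (hT.isDrawing.primitive f hf) hinf]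

/-- A tile containing points just to the left of the midpoint `m` of `ab` contains `m`, so `m` is
the midpoint of one of its sides. -/
lemma exists_tile (hT : IsTriangulation Ω T) (he : s(a, b) ∈ T)
    (hb : Disjoint (openSeg s(a, b)) (Ω.boundary ℝ)) : ∃ c, IsTile T a b c := by
  have hm := mid_mem s(a, b)
  set m := mid s(a, b)
  have hprim := hT.isDrawing.primitive _ he
  have hregion : ∀ᶠ z in nhds m, z ∈ region Ω \ Ω.boundary ℝ :=
    (isOpen_region_diff_boundary Ω).mem_nhds
      ⟨(hT.isEdge _ he).seg_subset (openSeg_subset_seg _ hm), Set.disjoint_left.1 hb hm⟩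
  obtain ⟨z, hz, ⟨hzΩ, -⟩, himp⟩ := ((hprim.frequently_orient_pos
    (orient_eq_zero_of_mem_seg (openSeg_subset_seg _ hm))).and_eventually
    (hregion.and (eventually_mem_triSet_imp T m))).exists
  obtain ⟨u, v, w, h, hzt⟩ := hT.cover hzΩ
  have exists_of_mid_eq {u v w : LatticePoint} (h : IsTile T u v w) (hzt : z ∈ triSet u v w)
      (hmid : m = mid s(u, v)) : ∃ c, IsTile T a b c := by
    rcases Sym2.eq_iff.1 (hT.isDrawing.eq_of_mid_eq he h.mem_ab hmid) with
      ⟨rfl, rfl⟩ | ⟨rfl, rfl⟩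
    · exact ⟨_, h⟩
    · have := hzt.1
      rw [orient_swap] at this
      linarith
  rcases mid_eq_of_mem_triSet h.area_eq hprim (himp u v w h hzt) with huv | hvw | hwu
  · exact exists_of_mid_eq h hzt huv
  · exact exists_of_mid_eq h.rotate (by rwa [triSet_rotate]) hvw
  · exact exists_of_mid_eq h.rotate.rotate (by rwa [triSet_rotate, triSet_rotate]) hwu

end IsTriangulation

end Triangulations

/-! ### Unimodular parallelograms -/

section Parallelograms

variable {a b c d p q r : LatticePoint} {e : Sym2 LatticePoint} {z : ℂ}

/-- Unimodular parallelograms `abcd`, listed counterclockwise: the quadrilaterals in which flips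
take place. -/
structure IsParallelogram (a b c d : LatticePoint) : Prop where
  sum_eq : a + c = b + d
  area_eq : area a b c = 1

/-- The points strictly to the left of `ab`, `bc`, `cd` and `da`, i.e. the interior of `abcd` when
this is a parallelogram listed counterclockwise. -/
def openQuad (a b c d : LatticePoint) : Set ℂ :=
  {z | 0 < orient a b z ∧ 0 < orient b c z ∧ 0 < orient c d z ∧ 0 < orient d a z}

namespace IsParallelogram

lemma fst_eq (h : IsParallelogram a b c d) : d.1 = a.1 + c.1 - b.1 := by
  have := congrArg Prod.fst h.sum_eq
  simp only [Prod.fst_add] at this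
  linarith

lemma snd_eq (h : IsParallelogram a b c d) : d.2 = a.2 + c.2 - b.2 := by
  have := congrArg Prod.snd h.sum_eq
  simp only [Prod.snd_add] at this
  linarith

lemma rotate (h : IsParallelogram a b c d) : IsParallelogram b c d a := by
  refine ⟨by rw [← h.sum_eq, add_comm], ?_⟩
  rw [← h.area_eq]
  simp only [area, h.fst_eq, h.snd_eq]
  ring

lemma area_abd (h : IsParallelogram a b c d) : area a b d = 1 := by
  rw [← area_rotate', h.rotate.rotate.rotate.area_eq]

lemma isPrimitive (h : IsParallelogram a b c d) : IsPrimitive s(a, b) :=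
  isPrimitive_of_area_eq_one h.area_eq

lemma ne (h : IsParallelogram a b c d) : a ≠ b := h.isPrimitive.ne

lemma ne_diagonal (h : IsParallelogram a b c d) : s(a, b) ≠ s(a, c) ∧ s(b, c) ≠ s(a, c) := by
  constructor <;> intro he <;> rcases Sym2.eq_iff.1 he with ⟨h₁, h₂⟩ | ⟨h₁, h₂⟩
  · exact h.rotate.ne h₂
  · exact h.ne h₂.symm
  · exact h.ne h₁.symm
  · exact h.rotate.ne h₁

lemma diagonal_ne_diagonal (h : IsParallelogram a b c d) : s(a, c) ≠ s(b, d) := by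
  intro he
  rcases Sym2.eq_iff.1 he with ⟨hab, -⟩ | ⟨-, hcb⟩
  · exact h.ne hab
  · exact h.rotate.ne hcb.symm

lemma mid_eq (h : IsParallelogram a b c d) : mid s(a, c) = mid s(b, d) :=
  mid_eq_mid_iff.2 h.sum_eq

lemma orient_add (h : IsParallelogram a b c d) (z : ℂ) : orient a b z + orient c d z = 1 := by
  have harea : (area a b c : ℝ) = 1 := by exact_mod_cast h.area_eq
  rw [← harea]
  simp only [orient, area, h.fst_eq, h.snd_eq]
  push_cast
  ring

lemma openSeg_subset_openQuad (h : IsParallelogram a b c d) :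
    openSeg s(b, d) ⊆ openQuad a b c d := by
  intro z hz
  obtain ⟨s, t, hs, ht, -, -, hcomb⟩ := exists_comb_of_mem_openSeg hz
  simp only [openQuad, Set.mem_ofPred_eq, hcomb]
  simp [h.area_abd, h.rotate.area_eq, h.rotate.rotate.area_abd, h.rotate.rotate.rotate.area_eq,
    hs, ht]

lemma pt_notMem_openQuad (h : IsParallelogram a b c d) (v : LatticePoint) :
    pt v ∉ openQuad a b c d := by
  rintro ⟨hab, -, hcd, -⟩
  have := h.orient_add (pt v)
  simp only [orient_pt] at hab hcd this
  norm_cast at hab hcd this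
  omega

lemma orient_nonneg_of_mem_convexHull (h : IsParallelogram a b c d)
    (hz : z ∈ convexHull ℝ {pt a, pt b, pt c, pt d}) : 0 ≤ orient a b z := by
  have hconv : Convex ℝ {z | 0 ≤ orient a b z} := by
    intro x hx y hy s t hs ht hst
    simp only [Set.mem_ofPred_eq, orient_comb _ _ _ _ hst] at *
    positivity
  refine convexHull_min ?_ hconv hz
  rintro w (rfl | rfl | rfl | rfl) <;> simp [h.area_eq, h.area_abd]

lemma orient_pos_of_mem_interior (h : IsParallelogram a b c d)
    (hz : z ∈ interior (convexHull ℝ {pt a, pt b, pt c, pt d})) : 0 < orient a b z := by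
  refine (h.orient_nonneg_of_mem_convexHull (interior_subset hz)).lt_of_ne' fun h0 => ?_
  have hba : orient b a z = 0 := by rw [orient_swap, h0, neg_zero]
  obtain ⟨w, hw, hwH⟩ := ((Sym2.eq_swap ▸ h.isPrimitive).frequently_orient_pos hba).and_eventually
    (mem_interior_iff_mem_nhds.1 hz) |>.exists
  rw [orient_swap] at hw
  linarith [h.orient_nonneg_of_mem_convexHull hwH]

lemma interior_convexHull_subset (h : IsParallelogram a b c d) :
    interior (convexHull ℝ {pt a, pt b, pt c, pt d}) ⊆ openQuad a b c d := by
  intro z hz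
  refine ⟨h.orient_pos_of_mem_interior hz, h.rotate.orient_pos_of_mem_interior ?_,
    h.rotate.rotate.orient_pos_of_mem_interior ?_,
    h.rotate.rotate.rotate.orient_pos_of_mem_interior ?_⟩ <;>
  convert hz using 3 <;>
  grind

lemma triSet_subset_union (h : IsParallelogram a b c d) :
    triSet a b c ⊆ triSet b c d ∪ triSet b d a := by
  rintro z ⟨hab, hbc, hca⟩
  have hsum := orient_sum a b c z
  rw [h.area_eq, Int.cast_one] at hsum
  have hcd : 0 ≤ orient c d z := by linarith [h.orient_add z]
  have hda : 0 ≤ orient d a z := by linarith [h.rotate.orient_add z]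
  rcases le_total (orient b d z) 0 with hbd | hbd
  · exact .inl ⟨hbc, hcd, by rw [orient_swap]; linarith⟩
  · exact .inr ⟨hbd, hda, hab⟩

end IsParallelogram

/-! ### Flips in triangulations -/

/-- Two tiles `abc` and `acd` that form a parallelogram: their common side `ac` can be flipped
to `bd`. -/
structure IsTilePair (T : Finset (Sym2 LatticePoint)) (a b c d : LatticePoint) : Prop where
  isParallelogram : IsParallelogram a b c d
  left : IsTile T a b c
  right : IsTile T a c d

namespace IsTilePair

lemma swap (h : IsTilePair T a b c d) : IsTilePair T c d a b :=
  ⟨h.isParallelogram.rotate.rotate, h.right.rotate, h.left.rotate.rotate⟩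

lemma flip (h : IsTilePair T a b c d) :
    IsTilePair (insert s(b, d) (T.erase s(a, c))) b c d a := by
  have hp := h.isParallelogram
  obtain ⟨hab, hbc⟩ := hp.ne_diagonal
  obtain ⟨hcd, hda⟩ := hp.rotate.rotate.ne_diagonal
  rw [Sym2.eq_swap (a := c) (b := a)] at hcd hda
  have hbda : area b d a = 1 := by rw [area_rotate, hp.area_abd]
  refine ⟨hp.rotate, ⟨?_, ?_, ?_, hp.rotate.area_eq⟩, ⟨?_, ?_, ?_, hbda⟩⟩
  · simp [hbc, h.left.mem_bc]
  · simp [hcd, h.right.mem_bc]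
  · simp [Sym2.eq_swap]
  · simp
  · simp [hda, h.right.mem_ca]
  · simp [hab, h.left.mem_ab]

lemma disjoint_seg_openQuad (h : IsTilePair T a b c d) (hT : IsDrawing T) (he : e ∈ T)
    (hne : e ≠ s(a, c)) : Disjoint (seg e) (openQuad a b c d) := by
  rw [Set.disjoint_left]
  intro z hze hz
  induction e with | h p q =>
  rcases mem_seg_iff.1 hze with rfl | rfl | hze
  · exact h.isParallelogram.pt_notMem_openQuad p hz
  · exact h.isParallelogram.pt_notMem_openQuad q hz
  · obtain ⟨hab, hbc, hcd, hda⟩ := hz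
    exact hne (hT.eq_diagonal h.left h.right he hze hab hbc hcd hda)

lemma disjoint_openSeg_added (h : IsTilePair T a b c d) (hT : IsDrawing T) (he : e ∈ T)
    (hne : e ≠ s(a, c)) : Disjoint (openSeg s(b, d)) (openSeg e) :=
  ((h.disjoint_seg_openQuad hT he hne).mono (openSeg_subset_seg e)
    h.isParallelogram.openSeg_subset_openQuad).symm

lemma nonCrossing_flip (h : IsTilePair T a b c d) (hT : IsDrawing T) :
    NonCrossing (insert s(b, d) (T.erase s(a, c))) := by
  have hadded {e} (he : e ∈ T.erase s(a, c)) : Disjoint (openSeg s(b, d)) (openSeg e) :=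
    h.disjoint_openSeg_added hT (Finset.mem_of_mem_erase he) (Finset.ne_of_mem_erase he)
  intro e he f hf hne
  rcases Finset.mem_insert.1 he with rfl | he <;> rcases Finset.mem_insert.1 hf with rfl | hf
  · exact absurd rfl hne
  · exact hadded hf
  · exact (hadded he).symm
  · exact hT.nonCrossing e (Finset.mem_of_mem_erase he) f (Finset.mem_of_mem_erase hf) hne

lemma disjoint_added_boundary (h : IsTilePair T a b c d) (hT : IsTriangulation Ω T)
    (hb : Disjoint (openSeg s(a, c)) (Ω.boundary ℝ)) :
    Disjoint (openSeg s(b, d)) (Ω.boundary ℝ) := by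
  rw [Set.disjoint_left]
  intro z hz hzb
  have hzQ := h.isParallelogram.openSeg_subset_openQuad hz
  obtain ⟨f, hf, hzf⟩ := Set.mem_iUnion₂.1 (hT.boundary_subset hzb)
  rcases eq_or_ne f s(a, c) with rfl | hne
  · rcases mem_seg_iff.1 hzf with rfl | rfl | hzf
    · exact h.isParallelogram.pt_notMem_openQuad a hzQ
    · exact h.isParallelogram.pt_notMem_openQuad c hzQ
    · exact Set.disjoint_left.1 hb hzf hzb
  · exact Set.disjoint_left.1 (h.disjoint_seg_openQuad hT.isDrawing hf hne) hzf hzQ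

lemma seg_added_subset_region (h : IsTilePair T a b c d) (hT : IsTriangulation Ω T) :
    seg s(b, d) ⊆ region Ω := by
  have tile_subset {p q r} (ht : IsTile T p q r) : triSet p q r ⊆ region Ω :=
    triSet_subset_region (by simp [ht.area_eq]) (hT.isEdge _ ht.mem_ab).seg_subset
      (hT.isEdge _ ht.mem_bc).seg_subset (hT.isEdge _ ht.mem_ca).seg_subset
  intro z hz
  rcases mem_seg_iff.1 hz with rfl | rfl | hz
  · exact (hT.isEdge _ h.left.mem_bc).seg_subset (left_mem_segment ..)
  · exact (hT.isEdge _ h.right.mem_ca).seg_subset (left_mem_segment ..)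
  obtain ⟨hab, hbc, hcd, hda⟩ := h.isParallelogram.openSeg_subset_openQuad hz
  rcases le_total (orient a c z) 0 with hac | hac
  · exact tile_subset h.left ⟨hab.le, hbc.le, by rw [orient_swap]; linarith⟩
  · exact tile_subset h.right ⟨hac, hcd.le, hda.le⟩

lemma boundary_subset_flip (h : IsTilePair T a b c d) (hT : IsTriangulation Ω T)
    (hb : Disjoint (openSeg s(a, c)) (Ω.boundary ℝ)) :
    Ω.boundary ℝ ⊆ ⋃ e ∈ insert s(b, d) (T.erase s(a, c)), seg e := by
  intro z hz
  obtain ⟨e, he, hze⟩ := Set.mem_iUnion₂.1 (hT.boundary_subset hz)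
  rcases eq_or_ne e s(a, c) with rfl | hne
  · rcases mem_seg_iff.1 hze with rfl | rfl | hze
    · exact Set.mem_iUnion₂.2 ⟨_, h.flip.right.mem_ca, left_mem_segment ..⟩
    · exact Set.mem_iUnion₂.2 ⟨_, h.flip.left.mem_bc, left_mem_segment ..⟩
    · exact absurd hz (Set.disjoint_left.1 hb hze)
  · exact Set.mem_iUnion₂.2 ⟨e, by simp [hne, he], hze⟩

lemma exists_tile_flip_of_side (h : IsTilePair T a b c d) (hT : IsDrawing T)
    (ht : IsTile T p q r) (hz : z ∈ triSet p q r) (hpq : s(p, q) = s(a, c)) :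
    ∃ u v w, IsTile (insert s(b, d) (T.erase s(a, c))) u v w ∧ z ∈ triSet u v w := by
  suffices z ∈ triSet b c d ∪ triSet b d a from this.elim
    (fun hz => ⟨_, _, _, h.flip.left, hz⟩) (fun hz => ⟨_, _, _, h.flip.right, hz⟩)
  rcases Sym2.eq_iff.1 hpq with ⟨rfl, rfl⟩ | ⟨rfl, rfl⟩
  · obtain rfl := hT.tile_unique ht h.right
    rw [← triSet_rotate] at hz
    have := h.swap.isParallelogram.triSet_subset_union hz
    rwa [← triSet_rotate r b q, triSet_rotate b r p, Set.union_comm] at this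
  · obtain rfl := hT.tile_unique ht h.left.rotate.rotate
    rw [← triSet_rotate] at hz
    exact h.isParallelogram.triSet_subset_union hz

lemma exists_tile_flip (h : IsTilePair T a b c d) (hT : IsTriangulation Ω T)
    (hz : z ∈ region Ω) :
    ∃ u v w, IsTile (insert s(b, d) (T.erase s(a, c))) u v w ∧ z ∈ triSet u v w := by
  obtain ⟨p, q, r, ht, hzt⟩ := hT.cover hz
  by_cases hpq : s(p, q) = s(a, c)
  · exact h.exists_tile_flip_of_side hT.isDrawing ht hzt hpq
  by_cases hqr : s(q, r) = s(a, c)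
  · exact h.exists_tile_flip_of_side hT.isDrawing ht.rotate (by rwa [triSet_rotate]) hqr
  by_cases hrp : s(r, p) = s(a, c)
  · exact h.exists_tile_flip_of_side hT.isDrawing ht.rotate.rotate
      (by rwa [triSet_rotate, triSet_rotate]) hrp
  · exact ⟨p, q, r, ⟨by simp [hpq, ht.mem_ab], by simp [hqr, ht.mem_bc], by simp [hrp, ht.mem_ca],
      ht.area_eq⟩, hzt⟩

lemma isTriangulation_flip (h : IsTilePair T a b c d) (hT : IsTriangulation Ω T)
    (hb : Disjoint (openSeg s(a, c)) (Ω.boundary ℝ)) :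
    IsTriangulation Ω (insert s(b, d) (T.erase s(a, c))) := by
  refine ⟨fun e he => ?_, h.nonCrossing_flip hT.isDrawing, h.boundary_subset_flip hT hb,
    fun z hz => ?_⟩
  · rcases Finset.mem_insert.1 he with rfl | he
    · exact ⟨isPrimitive_of_area_eq_one h.flip.right.area_eq, h.seg_added_subset_region hT,
        .inr (h.disjoint_added_boundary hT hb)⟩
    · exact hT.isEdge e (Finset.mem_of_mem_erase he)
  · obtain ⟨u, v, w, ht, hzt⟩ := h.exists_tile_flip hT hz
    refine ⟨u, v, w, ht.isFacet, ?_⟩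
    rwa [image_corners, convexHull_eq_triSet (by simp [ht.area_eq])]

lemma isConvexQuad (h : IsTilePair T a b c d) : IsConvexQuad a b c d := by
  refine ⟨⟨mid s(a, c), mid_mem s(a, c), ?_⟩, fun hcol => ?_⟩
  · rw [h.isParallelogram.mid_eq]
    exact mid_mem s(b, d)
  · have := area_eq_zero_of_collinear (hcol.subset
      (by grind : ({pt a, pt b, pt c} : Set ℂ) ⊆ {pt a, pt b, pt c, pt d}))
    simp [h.left.area_eq] at this

end IsTilePair

end Parallelograms

namespace Flip

variable {f : Flip} {a b c d : LatticePoint}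

/-- Flips that exchange the diagonals of a unimodular parallelogram; all flips of lattice
triangulations are of this kind (`IsFlip.applies`). -/
def IsUnimodular (f : Flip) : Prop :=
  ∃ a b c d, IsParallelogram a b c d ∧ f = ⟨s(a, c), s(b, d)⟩

/-- The sides of the quadrilateral of a flip: the segments joining an end of one diagonal to an
end of the other. -/
def sides (f : Flip) : Set (Sym2 LatticePoint) :=
  {e | ∃ x ∈ f.removed, ∃ y ∈ f.added, e = s(x, y)}

lemma sides_subset_iff {S : Set (Sym2 LatticePoint)} :
    Flip.sides ⟨s(a, c), s(b, d)⟩ ⊆ S ↔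
      s(a, b) ∈ S ∧ s(b, c) ∈ S ∧ s(c, d) ∈ S ∧ s(d, a) ∈ S := by
  constructor
  · exact fun h => ⟨h ⟨a, by simp, b, by simp, rfl⟩, h ⟨c, by simp, b, by simp, Sym2.eq_swap⟩,
      h ⟨c, by simp, d, by simp, rfl⟩, h ⟨a, by simp, d, by simp, Sym2.eq_swap⟩⟩
  · rintro ⟨hab, hbc, hcd, hda⟩ e ⟨x, hx, y, hy, rfl⟩
    rcases Sym2.mem_iff.1 hx with rfl | rfl <;> rcases Sym2.mem_iff.1 hy with rfl | rfl
    · exact hab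
    · rwa [Sym2.eq_swap]
    · rwa [Sym2.eq_swap]
    · exact hcd

/-- The combinatorial condition for the flip `f` to be performable on a triangulation `T` of `Ω`;
see `IsFlip.applies` and `Applies.isFlip`. -/
structure Applies (Ω : Polygon ℂ n) (T : Finset (Sym2 LatticePoint)) (f : Flip) : Prop where
  isUnimodular : f.IsUnimodular
  removed_mem : f.removed ∈ T
  sides_subset : f.sides ⊆ T
  disjoint_boundary : Disjoint (openSeg f.removed) (Ω.boundary ℝ)

/-- The result of performing a flip on an edge set. -/
def perform (f : Flip) (T : Finset (Sym2 LatticePoint)) : Finset (Sym2 LatticePoint) :=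
  insert f.added (T.erase f.removed)

lemma Applies.exists_isTilePair (h : f.Applies Ω T) :
    ∃ a b c d, f = ⟨s(a, c), s(b, d)⟩ ∧ IsTilePair T a b c d := by
  obtain ⟨⟨a, b, c, d, hp, rfl⟩, hac, hsides, -⟩ := h
  obtain ⟨hab, hbc, hcd, hda⟩ := sides_subset_iff.1 hsides
  exact ⟨a, b, c, d, rfl, hp, ⟨hab, hbc, Sym2.eq_swap ▸ hac, hp.area_eq⟩,
    ⟨hac, hcd, hda, by rw [← area_rotate, hp.rotate.rotate.area_eq]⟩⟩

lemma applies_of_isTilePair (h : IsTilePair T a b c d)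
    (hb : Disjoint (openSeg s(a, c)) (Ω.boundary ℝ)) : Applies Ω T ⟨s(a, c), s(b, d)⟩ :=
  ⟨⟨a, b, c, d, h.isParallelogram, rfl⟩, h.right.mem_ab, sides_subset_iff.2
    ⟨h.left.mem_ab, h.left.mem_bc, h.right.mem_bc, h.right.mem_ca⟩, hb⟩

lemma Applies.isTriangulation_perform (h : f.Applies Ω T) (hT : IsTriangulation Ω T) :
    IsTriangulation Ω (f.perform T) := by
  obtain ⟨a, b, c, d, rfl, hpair⟩ := h.exists_isTilePair
  exact hpair.isTriangulation_flip hT h.disjoint_boundary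

lemma Applies.isFlip (h : f.Applies Ω T) (hT : IsTriangulation Ω T) :
    IsFlip Ω T f (f.perform T) := by
  refine ⟨hT, h.isTriangulation_perform hT, rfl, ?_⟩
  obtain ⟨a, b, c, d, rfl, hpair⟩ := h.exists_isTilePair
  exact ⟨a, b, c, d, rfl, rfl, hpair.isConvexQuad, hpair.left.mem_ab, hpair.left.mem_bc,
    hpair.right.mem_bc, hpair.right.mem_ca, hpair.right.mem_ab, fun e he hne =>
      (hpair.disjoint_seg_openQuad hT.isDrawing he hne).mono_right
        hpair.isParallelogram.interior_convexHull_subset⟩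

end Flip

section Quadrilaterals

variable {a b c d p q z : LatticePoint} {w : ℂ} {f : Flip}

lemma seg_inter_interior_triSet_nonempty (h : 0 < area a b c) (hab : 0 < area a b z)
    (hca : 0 < area c a z) : (seg s(a, z) ∩ interior (triSet a b c)).Nonempty := by
  have hbc : ∀ᶠ t : ℝ in nhdsWithin 0 (Set.Ioi 0),
      0 < orient b c (AffineMap.lineMap (pt a) (pt z) t) := by
    have hcont : Continuous fun t : ℝ => orient b c (AffineMap.lineMap (pt a) (pt z) t) :=
      (continuous_orient b c).comp AffineMap.lineMap_continuous
    refine nhdsWithin_le_nhds (hcont.continuousAt.eventually (lt_mem_nhds ?_))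
    simpa [area_rotate] using h
  obtain ⟨t, hbct, ht0, ht1⟩ := (hbc.and (Ioo_mem_nhdsGT one_pos)).exists
  refine ⟨_, ⟨1 - t, t, by linarith, ht0.le, by ring, (AffineMap.lineMap_apply_module ..).symm⟩,
    mem_interior_iff_mem_nhds.2 (triSet_mem_nhds ?_ hbct ?_)⟩ <;>
  rw [AffineMap.lineMap_apply_module, orient_comb _ _ _ _ (by ring), orient_pt, orient_pt]
  · simpa using mul_pos ht0 (Int.cast_pos.2 hab)
  · simpa using mul_pos ht0 (Int.cast_pos.2 hca)

/-- A tile on the side `ca` of a triangle `abc` whose interior meets no other edge has its third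
corner at `b`: otherwise one of its two other sides enters the triangle, or it contains the lattice
point `b`. -/
lemma IsTile.eq_of_disjoint_interior (ht : IsTile T c a z) (h : 0 < area a b c)
    (hdisj : ∀ e ∈ T, e ≠ s(a, c) → Disjoint (seg e) (interior (triSet a b c))) : z = b := by
  have hza : z ≠ a := by
    rintro rfl
    simpa using ht.area_eq
  have hzc : z ≠ c := by
    rintro rfl
    simpa using ht.area_eq
  have hca : 0 < area c a z := by simp [ht.area_eq]
  have hab : area a b z ≤ 0 := not_lt.1 fun hab =>
    (seg_inter_interior_triSet_nonempty h hab hca).ne_empty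
      (hdisj _ ht.mem_bc (by grind)).inter_eq
  have hbc : area b c z ≤ 0 := not_lt.1 fun hbc => by
    have := seg_inter_interior_triSet_nonempty (by rwa [area_rotate']) hca hbc
    rw [← triSet_rotate c a b] at this
    exact this.ne_empty (hdisj _ (Sym2.eq_swap ▸ ht.mem_ca) (by grind)).inter_eq
  have hb : pt b ∈ triSet c a z := by
    refine ⟨?_, ?_, ?_⟩ <;> rw [orient_pt, Int.cast_nonneg_iff]
    · rw [area_rotate']
      exact h.le
    · rw [area_swap']
      omega
    · rw [← area_rotate, area_swap]
      omega
  rcases eq_corner_of_mem_triSet ht.area_eq hb with rfl | rfl | rfl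
  · simp at h
  · simp at h
  · rfl

lemma IsParallelogram.of_openSeg_inter (hb : area a b c = 1) (hd : area a c d = 1)
    (hac : w ∈ openSeg s(a, c)) (hbd : w ∈ openSeg s(b, d)) : IsParallelogram a b c d := by
  obtain ⟨s, t, -, -, hst, -, hwbd⟩ := exists_comb_of_mem_openSeg hbd
  obtain ⟨s', t', hs', ht', hst', -, hwac⟩ := exists_comb_of_mem_openSeg hac
  have hacb : area a c b = -1 := by rw [area_swap', hb]
  have hac0 := hwbd a c
  rw [hwac, hacb, hd, area_left, area_right] at hac0
  push_cast at hac0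
  have habd : area a b d = 1 := by
    have hab := hwbd a b
    rw [hwac, hb, area_left, area_right] at hab
    push_cast at hab
    have hpos : (0 : ℝ) < area a b d := by nlinarith
    have hlt : (area a b d : ℝ) < 2 := by nlinarith
    norm_cast at hpos hlt
    omega
  have hbcd : area b c d = 1 := by
    have := area_sum a b c d
    rw [area_swap a c d] at this
    omega
  suffices d = a + c - b from ⟨by rw [this]; abel, hb⟩
  have hab : area a b (a + c - b) = area a b c := by simp [area]; ring
  have hbc : area b c (a + c - b) = area a b c := by simp [area]; ring
  exact eq_of_area (by rw [hb]; norm_num) (by rw [habd, hab, hb]) (by rw [hbcd, hbc, hb])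

lemma area_signs_of_mem_openSeg (hz : w ∈ openSeg s(p, q)) (h0 : orient a b w = 0) :
    0 < area a b p ∧ area a b q < 0 ∨ area a b p < 0 ∧ 0 < area a b q ∨
      area a b p = 0 ∧ area a b q = 0 := by
  obtain ⟨s, t, hs, ht, -, -, hw⟩ := exists_comb_of_mem_openSeg hz
  have hsum : s * area a b p + t * area a b q = 0 := by rw [← hw, h0]
  rcases lt_trichotomy (area a b p) 0 with hp | hp | hp
  · have : (area a b p : ℝ) < 0 := by exact_mod_cast hp
    have : (0 : ℝ) < area a b q := by nlinarith
    exact .inr (.inl ⟨hp, by exact_mod_cast this⟩)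
  · simp only [hp, Int.cast_zero, mul_zero, zero_add, mul_eq_zero, ht.ne', false_or,
      Int.cast_eq_zero] at hsum
    exact .inr (.inr ⟨hp, hsum⟩)
  · have : (0 : ℝ) < area a b p := by exact_mod_cast hp
    have : (area a b q : ℝ) < 0 := by nlinarith
    exact .inl ⟨hp, by exact_mod_cast this⟩

lemma IsConvexQuad.area_pos (h : IsConvexQuad a b c d) (hac : a ≠ c) :
    0 < area a b c ∧ 0 < area a c d ∨ 0 < area a d c ∧ 0 < area a c b := by
  obtain ⟨⟨w, hwac, hwbd⟩, hcol⟩ := h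
  rw [area_swap' a c b, area_swap' a c d]
  rcases area_signs_of_mem_openSeg hwbd
    (orient_eq_zero_of_mem_seg (openSeg_subset_seg s(a, c) hwac)) with h | h | h
  · exact .inr (by omega)
  · exact .inl (by omega)
  · refine absurd (collinear_of_orient_eq_zero hac ?_) hcol
    rintro z (rfl | rfl | rfl | rfl) <;> simp [h.1, h.2]

lemma IsTriangulation.isTilePair (hT : IsTriangulation Ω T) (hac : s(a, c) ∈ T)
    (hb : Disjoint (openSeg s(a, c)) (Ω.boundary ℝ)) (habc : 0 < area a b c) (hacd : 0 < area a c d)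
    (hw : w ∈ openSeg s(a, c)) (hwbd : w ∈ openSeg s(b, d))
    (hdisj : ∀ e ∈ T, e ≠ s(a, c) →
      Disjoint (seg e) (interior (convexHull ℝ {pt a, pt b, pt c, pt d}))) :
    IsTilePair T a b c d := by
  have hdisj' {x y z} (hpos : 0 < area x y z)
      (hsub : ({pt x, pt y, pt z} : Set ℂ) ⊆ {pt a, pt b, pt c, pt d}) :
      ∀ e ∈ T, e ≠ s(a, c) → Disjoint (seg e) (interior (triSet x y z)) := fun e he hne =>
    (hdisj e he hne).mono_right (interior_mono (convexHull_eq_triSet hpos ▸ convexHull_mono hsub))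
  obtain ⟨b', hb'⟩ := hT.exists_tile (a := c) (b := a) (Sym2.eq_swap ▸ hac)
    (by rwa [Sym2.eq_swap])
  obtain ⟨d', hd'⟩ := hT.exists_tile hac hb
  obtain rfl := hb'.eq_of_disjoint_interior habc (hdisj' habc (by grind))
  have hcda : 0 < area c d a := by rwa [area_rotate]
  obtain rfl := hd'.eq_of_disjoint_interior hcda
    (Sym2.eq_swap (a := c) ▸ hdisj' hcda (by grind))
  exact ⟨.of_openSeg_inter hb'.rotate.area_eq hd'.area_eq hw hwbd, hb'.rotate, hd'⟩

lemma IsFlip.disjoint_boundary (h : IsFlip Ω T f T') :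
    Disjoint (openSeg f.removed) (Ω.boundary ℝ) := by
  obtain ⟨hT, hT', rfl, a, b, c, d, hr, ha, ⟨⟨w, hwac, hwbd⟩, hcol⟩, -, -, -, -, hac, -⟩ := h
  have hbd := hT'.isEdge f.added (Finset.mem_insert_self ..)
  rw [ha] at hbd
  rw [hr]
  refine (hT.isEdge _ hac).boundary.resolve_left fun hb => ?_
  have hbdb := hbd.boundary.resolve_right fun hdisj => Set.disjoint_left.1 hdisj hwbd (hb hwac)
  have hbdT := hT.mem_of_subset_boundary hbd.primitive hbdb
  apply hcol
  have heq := hT.isDrawing.eq_of_mem hac hbdT hwac hwbd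
  convert collinear_pair ℝ (pt a) (pt c) using 1
  grind

lemma IsFlip.applies (h : IsFlip Ω T f T') : f.Applies Ω T := by
  have hb := h.disjoint_boundary
  obtain ⟨hT, -, -, a, b, c, d, hr, ha, hquad, -, -, -, -, hac, hdisj⟩ := h
  obtain rfl : f = ⟨s(a, c), s(b, d)⟩ := Flip.ext hr ha
  obtain ⟨w, hwac, hwbd⟩ := hquad.1
  rcases hquad.area_pos (hT.isEdge _ hac).primitive.ne with ⟨habc, hacd⟩ | ⟨hadc, hacb⟩
  · exact Flip.applies_of_isTilePair (hT.isTilePair hac hb habc hacd hwac hwbd hdisj) hb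
  · rw [show ({pt a, pt b, pt c, pt d} : Set ℂ) = {pt a, pt d, pt c, pt b} by grind] at hdisj
    rw [Sym2.eq_swap (a := b)]
    exact Flip.applies_of_isTilePair
      (hT.isTilePair hac hb hadc hacb hwac (Sym2.eq_swap (a := d) ▸ hwbd) hdisj) hb

lemma IsFlip.eq_perform (h : IsFlip Ω T f T') : T' = f.perform T := h.eq_insert_erase

end Quadrilaterals

/-! ### Edge lengths -/

/-- The square of the Euclidean length of `e`, see `edgeLength_eq`. -/
def sqLen (e : Sym2 LatticePoint) : ℤ :=
  Sym2.lift ⟨fun a b => (b.1 - a.1) ^ 2 + (b.1 - a.1) * (b.2 - a.2) + (b.2 - a.2) ^ 2,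
    fun a b => by ring⟩ e

section Lengths

variable {a b c d p q r r' : LatticePoint} {e f : Sym2 LatticePoint}

@[simp] lemma sqLen_mk (a b : LatticePoint) : sqLen s(a, b) =
    (b.1 - a.1) ^ 2 + (b.1 - a.1) * (b.2 - a.2) + (b.2 - a.2) ^ 2 := rfl

lemma edgeLength_eq (e : Sym2 LatticePoint) : edgeLength e = Real.sqrt (sqLen e) := by
  induction e with | h a b =>
  change dist (pt a) (pt b) = _
  rw [Complex.dist_eq_re_im, pt_re, pt_re, pt_im, pt_im]
  congr 1
  have hsqrt : Real.sqrt 3 ^ 2 = 3 := Real.sq_sqrt (by norm_num)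
  simp only [sqLen_mk]
  push_cast
  linear_combination ((a.2 : ℝ) - b.2) ^ 2 / 4 * hsqrt

lemma sqLen_nonneg (e : Sym2 LatticePoint) : 0 ≤ sqLen e := by
  induction e with | h a b =>
  rw [sqLen_mk]
  nlinarith [sq_nonneg (b.1 - a.1 + (b.2 - a.2)), sq_nonneg (b.1 - a.1), sq_nonneg (b.2 - a.2)]

lemma eq_of_sqLen_eq_zero (h : sqLen s(a, b) = 0) : a = b := by
  rw [sqLen_mk] at h
  have h2 : b.2 - a.2 = 0 := by nlinarith [sq_nonneg (2 * (b.1 - a.1) + (b.2 - a.2))]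
  have h1 : b.1 - a.1 = 0 := by nlinarith
  exact Prod.ext (by linarith) (by linarith)

lemma IsPrimitive.sqLen_pos (h : IsPrimitive e) : 0 < sqLen e := by
  induction e with | h a b =>
  exact (sqLen_nonneg _).lt_of_ne fun h0 => h.ne (eq_of_sqLen_eq_zero h0.symm)

lemma edgeLength_lt_iff : edgeLength e < edgeLength f ↔ sqLen e < sqLen f := by
  rw [edgeLength_eq, edgeLength_eq, Real.sqrt_lt_sqrt_iff (by exact_mod_cast sqLen_nonneg e)]
  exact Int.cast_lt

lemma edgeLength_inj : edgeLength e = edgeLength f ↔ sqLen e = sqLen f := by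
  rw [edgeLength_eq, edgeLength_eq, Real.sqrt_inj (by exact_mod_cast sqLen_nonneg e)
    (by exact_mod_cast sqLen_nonneg f)]
  exact Int.cast_inj

lemma IsParallelogram.sqLen_add_sqLen (h : IsParallelogram a b c d) :
    sqLen s(a, c) + sqLen s(b, d) = 2 * (sqLen s(b, a) + sqLen s(a, d)) := by
  simp only [sqLen_mk, h.fst_eq, h.snd_eq]
  ring

lemma four_mul_sqLen_mul_sqLen (a b c : LatticePoint) :
    4 * (sqLen s(b, c) * sqLen s(c, a)) =
      3 * area a b c ^ 2 + (sqLen s(a, b) - sqLen s(b, c) - sqLen s(c, a)) ^ 2 := by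
  simp only [sqLen_mk, area]
  ring

/-- By Heron's formula, the angle opposite to the longest side is obtuse. -/
lemma sqLen_add_sqLen_lt (h : area a b c = 1) (hbc : sqLen s(b, c) ≤ sqLen s(a, b))
    (hca : sqLen s(c, a) ≤ sqLen s(a, b)) (hab : sqLen s(a, b) ≠ 1) :
    sqLen s(b, c) + sqLen s(c, a) < sqLen s(a, b) := by
  by_contra! hle
  have heron := four_mul_sqLen_mul_sqLen a b c
  rw [h] at heron
  set P := sqLen s(b, c)
  set R := sqLen s(c, a)
  obtain ⟨t, ht⟩ : ∃ t, sqLen s(a, b) = P + R - t := ⟨P + R - sqLen s(a, b), by ring⟩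
  rw [ht] at heron hle hbc hca hab
  have ht0 : 0 ≤ t := by linarith
  have htt : t * t ≤ P * R := mul_le_mul (by linarith) (by linarith) ht0 (by linarith)
  have ht1 : t ≤ 1 := by nlinarith
  obtain rfl | rfl : t = 0 ∨ t = 1 := by omega
  · have : 4 * (P * R) = 3 := by linarith
    omega
  · have hPR : P * R = 1 := by linarith
    rcases Int.mul_eq_one_iff_eq_one_or_neg_one.1 hPR with hone | hone <;> omega

/-- Two points `r` and `r'` at the same distance from the line `pq` differ by a multiple of `q - p`,
so they cannot lie both in the interior of the circle with diameter `pq`. -/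
lemma IsPrimitive.eq_of_sqLen_add_lt (h : IsPrimitive s(p, q)) (harea : area p q r = area p q r')
    (hr : sqLen s(p, r) + sqLen s(r, q) < sqLen s(p, q))
    (hr' : sqLen s(p, r') + sqLen s(r', q) < sqLen s(p, q)) : r = r' := by
  obtain ⟨k, rfl⟩ := h.exists_eq_add_zsmul harea
  have hpos := h.sqLen_pos
  have hk : k ^ 2 * sqLen s(p, q) < 1 * sqLen s(p, q) := by
    have hsum := sqLen_nonneg s(p + q, r + (r + k • (q - p)))
    simp only [sqLen_mk, Prod.fst_add, Prod.snd_add, Prod.smul_fst, Prod.smul_snd, Prod.fst_sub,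
      Prod.snd_sub, smul_eq_mul] at *
    linarith
  have : k ^ 2 < 1 := lt_of_mul_lt_mul_right hk hpos.le
  obtain rfl : k = 0 := by nlinarith
  simp

lemma isParallelogram_of_sqLen_add_lt (h : area p q r = 1) (h' : area q p r' = 1)
    (hr : sqLen s(p, r) + sqLen s(r, q) < sqLen s(p, q))
    (hr' : sqLen s(p, r') + sqLen s(r', q) < sqLen s(p, q)) : IsParallelogram p r' q r := by
  have hprim : IsPrimitive s(p, q) := isPrimitive_of_area_eq_one h
  have hreflect : area p q (p + q - r') = area q p r' := by
    simp only [area, Prod.fst_add, Prod.snd_add, Prod.fst_sub, Prod.snd_sub]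
    ring
  obtain rfl := hprim.eq_of_sqLen_add_lt (hreflect.trans (h'.trans h.symm)) (by
    simp only [sqLen_mk, Prod.fst_add, Prod.snd_add, Prod.fst_sub, Prod.snd_sub] at hr' ⊢
    linarith) hr
  exact ⟨by abel, by rwa [area_rotate]⟩

lemma eq_of_mid_eq_of_sqLen_eq_one (he : sqLen e = 1) (hf : sqLen f = 1) (h : mid e = mid f) :
    e = f := by
  induction e with | h a b =>
  induction f with | h c d =>
  have hsum := mid_eq_mid_iff.1 h
  have h1 := congrArg Prod.fst hsum
  have h2 := congrArg Prod.snd hsum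
  have hunit : sqLen s(a, c) + sqLen s(a, d) = 1 := by
    simp only [Prod.fst_add, Prod.snd_add, sqLen_mk] at *
    obtain ⟨hd1, hd2⟩ : d.1 = a.1 + b.1 - c.1 ∧ d.2 = a.2 + b.2 - c.2 := by omega
    rw [hd1, hd2] at hf ⊢
    linarith
  have hac := sqLen_nonneg s(a, c)
  have had := sqLen_nonneg s(a, d)
  obtain h0 | h0 : sqLen s(a, c) = 0 ∨ sqLen s(a, d) = 0 := by omega
  · obtain rfl := eq_of_sqLen_eq_zero h0
    rw [add_left_cancel hsum]
  · obtain rfl := eq_of_sqLen_eq_zero h0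
    rw [add_comm c] at hsum
    rw [add_left_cancel hsum, Sym2.eq_swap]

lemma IsEquilateralTriangulation.sqLen_eq_one (h : IsEquilateralTriangulation Ω T) :
    ∀ e ∈ T, sqLen e = 1 := by
  obtain ⟨hT, l, hl⟩ := h
  intro e he
  obtain ⟨a, b, c, ht, -⟩ := hT.exists_mid_eq (hT.isEdge e he)
  have heq {f} (hf : f ∈ T) : sqLen f = sqLen e := edgeLength_inj.1 ((hl f hf).trans (hl e he).symm)
  have hbc := heq ht.mem_bc
  have hca := heq ht.mem_ca
  have hab := heq ht.mem_ab
  by_contra hne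
  have := sqLen_add_sqLen_lt ht.area_eq (hbc.trans hab.symm).le (hca.trans hab.symm).le
    (hab ▸ hne)
  linarith [sqLen_nonneg e]

namespace IsTriangulation

lemma subset_of_sqLen_eq_one (hT : IsTriangulation Ω T) (hT' : IsTriangulation Ω T')
    (h : ∀ e ∈ T, sqLen e = 1) (h' : ∀ e ∈ T', sqLen e = 1) : T ⊆ T' := by
  intro e he
  obtain ⟨a, b, c, ht, hm⟩ := hT'.exists_mid_eq (hT.isEdge e he)
  rw [eq_of_mid_eq_of_sqLen_eq_one (h e he) (h' _ ht.mem_ab) hm]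
  exact ht.mem_ab

lemma disjoint_boundary_of_sqLen_ne_one (hT : IsTriangulation Ω T) (hu : ∀ e ∈ T, sqLen e = 1)
    (he : IsEdge Ω e) (h : sqLen e ≠ 1) : Disjoint (openSeg e) (Ω.boundary ℝ) :=
  he.boundary.resolve_left fun hb => h (hu e (hT.mem_of_subset_boundary he.primitive hb))

end IsTriangulation

end Lengths

/-! ### Lengthening flips -/

namespace Flip

variable {f g : Flip} {p q : LatticePoint}

/-- A flip that replaces the shorter diagonal of a parallelogram by the longer one. -/
structure Lengthens (f : Flip) : Prop where
  isUnimodular : f.IsUnimodular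
  sqLen_lt : sqLen f.removed < sqLen f.added

/-- The reverse flip. -/
@[simps] def symm (f : Flip) : Flip := ⟨f.added, f.removed⟩

lemma IsUnimodular.symm (h : f.IsUnimodular) : f.symm.IsUnimodular := by
  obtain ⟨a, b, c, d, h, rfl⟩ := h
  exact ⟨b, c, d, a, h.rotate, by rw [Flip.symm, Sym2.eq_swap (a := a)]⟩

lemma IsUnimodular.lengthens_or (h : f.IsUnimodular) : f.Lengthens ∨ f.symm.Lengthens := by
  rcases lt_trichotomy (sqLen f.removed) (sqLen f.added) with hlt | heq | hgt
  · exact .inl ⟨h, hlt⟩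
  · obtain ⟨a, b, c, d, hp, rfl⟩ := h
    have harea := hp.area_eq
    simp only [sqLen_mk, hp.fst_eq, hp.snd_eq, area] at heq harea
    have : 2 * ((a.1 - b.1) * (c.1 - b.1) + (a.2 - b.2) * (c.2 - b.2) +
      (a.2 - b.2) * (c.1 - b.1)) = 1 := by linarith
    omega
  · exact .inr ⟨h.symm, hgt⟩

lemma Lengthens.exists_isParallelogram (h : f.Lengthens) (hadd : f.added = s(p, q)) :
    ∃ a c, f.removed = s(a, c) ∧ IsParallelogram a p c q ∧
      sqLen s(p, a) + sqLen s(a, q) < sqLen s(p, q) := by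
  obtain ⟨⟨a, b, c, d, hp, rfl⟩, hlt⟩ := h
  suffices ∃ a' c', s(a, c) = s(a', c') ∧ IsParallelogram a' p c' q by
    obtain ⟨a', c', hac, hp'⟩ := this
    rw [hadd, hac] at hlt
    exact ⟨a', c', hac, hp', by linarith [hp'.sqLen_add_sqLen]⟩
  rcases Sym2.eq_iff.1 hadd with ⟨rfl, rfl⟩ | ⟨rfl, rfl⟩
  · exact ⟨a, c, rfl, hp⟩
  · exact ⟨c, a, Sym2.eq_swap, hp.rotate.rotate⟩

lemma Lengthens.eq_of_added_eq (hf : f.Lengthens) (hg : g.Lengthens) (h : f.added = g.added) :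
    f = g := by
  refine Flip.ext ?_ h
  induction hadd : g.added with | h p q =>
  obtain ⟨a, c, hac, hp, hlt⟩ := hf.exists_isParallelogram (h.trans hadd)
  obtain ⟨a', c', hac', hp', hlt'⟩ := hg.exists_isParallelogram hadd
  have harea : area p q a = 1 := by rw [area_rotate, hp.area_abd]
  have harea' : area p q a' = 1 := by rw [area_rotate, hp'.area_abd]
  obtain rfl : a = a' := (isPrimitive_of_area_eq_one harea).eq_of_sqLen_add_lt
    (harea.trans harea'.symm) hlt hlt'
  rw [hac, hac', add_left_cancel (hp.sum_eq.trans hp'.sum_eq.symm)]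

namespace Applies

lemma added_notMem (h : f.Applies Ω T) (hT : IsTriangulation Ω T) : f.added ∉ T := by
  obtain ⟨a, b, c, d, rfl, hpair⟩ := h.exists_isTilePair
  exact fun hmem => hpair.isParallelogram.diagonal_ne_diagonal
    (hT.isDrawing.eq_of_mid_eq h.removed_mem hmem hpair.isParallelogram.mid_eq)

lemma symm (h : f.Applies Ω T) (hT : IsTriangulation Ω T) : f.symm.Applies Ω (f.perform T) := by
  obtain ⟨a, b, c, d, rfl, hpair⟩ := h.exists_isTilePair
  have hswap : (⟨s(a, c), s(b, d)⟩ : Flip).symm = ⟨s(b, d), s(c, a)⟩ := by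
    rw [Flip.symm, Sym2.eq_swap]
  rw [hswap]
  exact applies_of_isTilePair (T := insert s(b, d) (T.erase s(a, c))) hpair.flip
    (hpair.disjoint_added_boundary hT h.disjoint_boundary)

lemma symm_perform (h : f.Applies Ω T) (hT : IsTriangulation Ω T) :
    f.symm.perform (f.perform T) = T := by
  simp only [perform, symm_added, symm_removed]
  rw [Finset.erase_insert fun hm => h.added_notMem hT (Finset.mem_of_mem_erase hm),
    Finset.insert_erase h.removed_mem]

lemma sum_perform {M : Type*} [AddCommMonoid M] (h : f.Applies Ω T) (hT : IsTriangulation Ω T)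
    (φ : Sym2 LatticePoint → M) :
    ∑ e ∈ f.perform T, φ e + φ f.removed = ∑ e ∈ T, φ e + φ f.added := by
  rw [perform, Finset.sum_insert fun hm => h.added_notMem hT (Finset.mem_of_mem_erase hm),
    add_assoc, Finset.sum_erase_add _ _ h.removed_mem, add_comm]

end Applies

end Flip

/-- The third corners of the two tiles on a longest edge lie inside the circle on which this edge is
a diameter. -/
lemma IsTriangulation.exists_applies_lengthens_symm (hT : IsTriangulation Ω T)
    (hT₀ : IsTriangulation Ω T₀) (hu : ∀ e ∈ T₀, sqLen e = 1) (h : ∃ e ∈ T, sqLen e ≠ 1) :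
    ∃ f : Flip, f.Applies Ω T ∧ f.symm.Lengthens := by
  obtain ⟨e₀, he₀, hne₀⟩ := h
  obtain ⟨e, he, hmax⟩ := T.exists_max_image sqLen ⟨e₀, he₀⟩
  have hne : sqLen e ≠ 1 := by
    have hle := hmax e₀ he₀
    have hpos := (hT.isEdge _ he₀).primitive.sqLen_pos
    omega
  have hdisj := hT₀.disjoint_boundary_of_sqLen_ne_one hu (hT.isEdge e he) hne
  induction e with | h p q =>
  obtain ⟨r, hr⟩ := hT.exists_tile he hdisj
  have hlt := sqLen_add_sqLen_lt hr.area_eq (hmax _ hr.mem_bc) (hmax _ hr.mem_ca) hne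
  have hswap : s(p, q) = s(q, p) := Sym2.eq_swap
  obtain ⟨r', hr'⟩ := hT.exists_tile (hswap ▸ he) (hswap ▸ hdisj)
  have hlt' : sqLen s(p, r') + sqLen s(r', q) < sqLen s(p, q) := by
    rw [hswap] at hmax hne ⊢
    exact sqLen_add_sqLen_lt hr'.area_eq (hmax _ hr'.mem_bc) (hmax _ hr'.mem_ca) hne
  have hp := isParallelogram_of_sqLen_add_lt hr.area_eq hr'.area_eq
    (by rwa [add_comm, Sym2.eq_swap, Sym2.eq_swap (a := q)] at hlt) hlt'
  refine ⟨⟨s(p, q), s(r', r)⟩, Flip.applies_of_isTilePair ⟨hp, hr'.rotate, hr⟩ hdisj,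
    Flip.IsUnimodular.symm ⟨p, r', q, r, hp, rfl⟩, ?_⟩
  have hsum := hp.rotate.sqLen_add_sqLen
  rw [Sym2.eq_swap (a := q), Sym2.eq_swap (a := q), Sym2.eq_swap (b := p)] at hsum
  simp only [Flip.symm_removed, Flip.symm_added]
  linarith

/-! ### Constrained triangulations -/

section Crossing

variable {a b c d p q v z : LatticePoint} {e f : Sym2 LatticePoint}

lemma eq_corner_of_mem_convexHull (h : |area a b c| = 1)
    (hv : pt v ∈ convexHull ℝ {pt a, pt b, pt c}) : v = a ∨ v = b ∨ v = c := by
  rcases (abs_eq one_pos.le).1 h with h | h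
  · rw [convexHull_eq_triSet (by omega)] at hv
    exact eq_corner_of_mem_triSet h hv
  · have h' : area b a c = 1 := by rw [area_swap, h, neg_neg]
    rw [Set.insert_comm, convexHull_eq_triSet (by omega)] at hv
    rcases eq_corner_of_mem_triSet h' hv with hv | hv | hv <;> simp only [hv, true_or, or_true]

lemma lineMap_mem_openSegment {V : Type*} [AddCommGroup V] [Module ℝ V] {K : Set V} {x y u : V}
    {r : ℝ} (hK : Convex ℝ K) (hx : x ∉ K) (hy : y ∉ K) (hu : u ∈ openSegment ℝ x y)
    (huK : u ∈ K) (hr : AffineMap.lineMap x y r ∈ K) :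
    AffineMap.lineMap x y r ∈ openSegment ℝ x y := by
  rw [openSegment_eq_image_lineMap] at hu ⊢
  obtain ⟨s, ⟨hs0, hs1⟩, rfl⟩ := hu
  have hI := (hK.affine_preimage (AffineMap.lineMap x y : ℝ →ᵃ[ℝ] V)).ordConnected.uIcc_subset
    huK hr
  have h0 : (0 : ℝ) ∉ Set.uIcc s r := fun h => hx (by simpa using hI h)
  have h1 : (1 : ℝ) ∉ Set.uIcc s r := fun h => hy (by simpa using hI h)
  refine ⟨r, ⟨?_, ?_⟩, rfl⟩ <;> by_contra! hcon
  · exact h0 (Set.mem_uIcc.2 (.inr ⟨hcon, hs0.le⟩))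
  · exact h1 (Set.mem_uIcc.2 (.inl ⟨hs1.le, hcon⟩))

lemma exists_mem_openSeg_orient_eq_zero (hp : 0 < area a b p) (hq : area a b q < 0) :
    ∃ x ∈ openSeg s(p, q), orient a b x = 0 := by
  have hp' : (0 : ℝ) < area a b p := by exact_mod_cast hp
  have hq' : (area a b q : ℝ) < 0 := by exact_mod_cast hq
  have hd : (0 : ℝ) < area a b p - area a b q := by linarith
  have hst : (-area a b q / (area a b p - area a b q) : ℝ) +
      area a b p / (area a b p - area a b q) = 1 := by
    field_simp
    ring
  refine ⟨_, ⟨_, _, div_pos (neg_pos.2 hq') hd, div_pos hp' hd, hst, rfl⟩, ?_⟩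
  rw [orient_comb _ _ _ _ hst, orient_pt, orient_pt]
  field_simp
  ring

/-- The crossing point of `zb` with the line `pq` lies between `p` and `q` since these points are
outside of the triangle `abz`, which the segment `pq` meets. -/
lemma not_disjoint_of_crossing (h : |area a b z| = 1)
    (hcross : ¬ Disjoint (openSeg s(p, q)) (openSeg s(a, b))) (ha : 0 < area p q a)
    (hb : area p q b < 0) (hz : 0 < area p q z) :
    ¬ Disjoint (openSeg s(p, q)) (openSeg s(z, b)) := by
  have hK := convex_convexHull ℝ {pt a, pt b, pt z}
  have hcorner : {pt a, pt b, pt z} ⊆ convexHull ℝ {pt a, pt b, pt z} := subset_convexHull ℝ _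
  have hnot {v} (hv : area p q v = 0) : pt v ∉ convexHull ℝ {pt a, pt b, pt z} := fun hmem => by
    rcases eq_corner_of_mem_convexHull h hmem with rfl | rfl | rfl <;> omega
  have hpq : p ≠ q := by
    rintro rfl
    simp only [area_same, lt_irrefl] at ha
  obtain ⟨y, hypq, hyab⟩ := Set.not_disjoint_iff.1 hcross
  obtain ⟨x, hx, hx0⟩ := exists_mem_openSeg_orient_eq_zero hz hb
  obtain ⟨r, rfl⟩ := exists_lineMap_of_orient_eq_zero hpq hx0
  refine Set.not_disjoint_iff.2 ⟨_, lineMap_mem_openSegment hK (hnot (area_left _ _))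
    (hnot (area_right _ _)) hypq ?_ ?_, hx⟩
  · exact hK.openSegment_subset (hcorner (by simp)) (hcorner (by simp)) hyab
  · exact hK.openSegment_subset (hcorner (by simp)) (hcorner (by simp)) hx

/-- The extent of `f` transverse to `pq` if `f` crosses `pq`, and `0` otherwise. It measures the
progress of the flips that clear the way for the edge `pq`. -/
noncomputable def crossWidth (p q : LatticePoint) (f : Sym2 LatticePoint) : ℤ :=
  open Classical in
  if Disjoint (openSeg s(p, q)) (openSeg f) then 0 else
    Sym2.lift ⟨fun x y => |area p q x - area p q y|, fun _ _ => abs_sub_comm _ _⟩ f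

lemma crossWidth_of_not_disjoint (h : ¬ Disjoint (openSeg s(p, q)) (openSeg s(a, b))) :
    crossWidth p q s(a, b) = |area p q a - area p q b| := if_neg h

lemma not_disjoint_of_crossWidth_pos (h : 0 < crossWidth p q f) :
    ¬ Disjoint (openSeg s(p, q)) (openSeg f) := fun hd => h.ne' (if_pos hd)

lemma crossWidth_nonneg (p q : LatticePoint) (f : Sym2 LatticePoint) : 0 ≤ crossWidth p q f := by
  unfold crossWidth
  split_ifs
  · exact le_rfl
  · induction f with | h a b => exact abs_nonneg _

lemma crossWidth_le (p q a b : LatticePoint) :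
    crossWidth p q s(a, b) ≤ |area p q a - area p q b| := by
  unfold crossWidth
  split_ifs
  · exact abs_nonneg _
  · exact le_rfl

lemma crossWidth_swap (p q : LatticePoint) (f : Sym2 LatticePoint) :
    crossWidth q p f = crossWidth p q f := by
  induction f with | h a b =>
  unfold crossWidth
  rw [(Sym2.eq_swap : s(q, p) = s(p, q))]
  simp only [area_swap p q, Sym2.lift_mk, neg_sub_neg, abs_sub_comm (area p q b)]

lemma area_lt_of_crossWidth_le (hpq : IsPrimitive s(p, q)) (h : |area a b z| = 1)
    (hcross : ¬ Disjoint (openSeg s(p, q)) (openSeg s(a, b))) (ha : 0 < area p q a)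
    (hb : area p q b < 0) (hle : crossWidth p q s(z, b) ≤ crossWidth p q s(a, b)) :
    area p q z < area p q a := by
  by_contra! hge
  rw [crossWidth_of_not_disjoint hcross, crossWidth_of_not_disjoint
    (not_disjoint_of_crossing h hcross ha hb (by omega)), abs_of_pos (by omega),
    abs_of_pos (by omega)] at hle
  obtain ⟨k, rfl⟩ := hpq.exists_eq_add_zsmul (p := a) (q := z) (by omega)
  have hk : area a b (a + k • (q - p)) = k * (area p q a - area p q b) := by
    rw [area_add_zsmul_sub, area_left]
    simp only [area]
    ring
  have := Int.le_of_dvd one_pos (h ▸ (dvd_abs _ _).2 (hk ▸ Dvd.intro_left k rfl))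
  omega

lemma area_between_of_crossWidth_le (hpq : IsPrimitive s(p, q)) (h : |area a b z| = 1)
    (hcross : ¬ Disjoint (openSeg s(p, q)) (openSeg s(a, b))) (ha : 0 < area p q a)
    (hb : area p q b < 0) (hzb : crossWidth p q s(z, b) ≤ crossWidth p q s(a, b))
    (hza : crossWidth p q s(z, a) ≤ crossWidth p q s(a, b)) :
    area p q b < area p q z ∧ area p q z < area p q a := by
  refine ⟨?_, area_lt_of_crossWidth_le hpq h hcross ha hb hzb⟩
  rw [Sym2.eq_swap (a := p)] at hpq hcross
  rw [Sym2.eq_swap (a := a)] at hcross hza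
  rw [← crossWidth_swap, ← crossWidth_swap p] at hza
  have hlt := area_lt_of_crossWidth_le hpq (by rwa [area_swap, abs_neg]) hcross
    (by rw [area_swap]; omega) (by rw [area_swap]; omega) hza
  rwa [area_swap, area_swap p, neg_lt_neg_iff] at hlt

lemma isParallelogram_of_area_between (hd : area a c d = 1) (hb : area c a b = 1)
    (hdpq : area p q c < area p q d ∧ area p q d < area p q a)
    (hbpq : area p q c < area p q b ∧ area p q b < area p q a) : IsParallelogram a b c d := by
  have hprim : IsPrimitive s(a, c) := isPrimitive_of_area_eq_one hd
  have hreflect : area a c (a + c - b) = area c a b := by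
    simp only [area, Prod.fst_add, Prod.snd_add, Prod.fst_sub, Prod.snd_sub]
    ring
  obtain ⟨k, rfl⟩ := hprim.exists_eq_add_zsmul (hreflect.trans (hb.trans hd.symm))
  have hk : area p q (a + c - b + k • (c - a)) =
      area p q a + area p q c - area p q b + k * (area p q c - area p q a) := by
    rw [area_add_zsmul_sub]
    simp only [area, Prod.fst_add, Prod.snd_add, Prod.fst_sub, Prod.snd_sub]
    ring
  have hk1 : k < 1 := by nlinarith
  have hk2 : -1 < k := by nlinarith
  obtain rfl : k = 0 := by omega
  exact ⟨by rw [zero_smul]; abel, by rwa [area_rotate]⟩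

namespace IsTriangulation

lemma exists_area_pos_neg (hT : IsTriangulation Ω T) (hpq : IsPrimitive s(p, q))
    (hn : s(p, q) ∉ T) (hf : f ∈ T) (hcross : ¬ Disjoint (openSeg s(p, q)) (openSeg f)) :
    ∃ a b, f = s(a, b) ∧ 0 < area p q a ∧ area p q b < 0 := by
  induction f with | h a b =>
  obtain ⟨y, hypq, hyab⟩ := Set.not_disjoint_iff.1 hcross
  rcases area_signs_of_mem_openSeg hyab (orient_eq_zero_of_mem_seg (openSeg_subset_seg _ hypq))
    with ⟨ha, hb⟩ | ⟨ha, hb⟩ | ⟨ha, hb⟩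
  · exact ⟨a, b, rfl, ha, hb⟩
  · exact ⟨b, a, Sym2.eq_swap, hb, ha⟩
  · refine absurd ?_ hn
    rwa [hpq.eq_of_parallel (hT.isEdge _ hf).primitive (ha.trans hb.symm) hypq hyab]

lemma disjoint_boundary_of_not_disjoint (hT : IsTriangulation Ω T) (he : IsEdge Ω e) (hn : e ∉ T)
    (hf : f ∈ T) (hcross : ¬ Disjoint (openSeg e) (openSeg f)) :
    Disjoint (openSeg f) (Ω.boundary ℝ) := by
  refine (hT.isEdge f hf).boundary.resolve_left fun hfb => hcross ?_
  have hb := he.boundary.resolve_left fun heb => hn (hT.mem_of_subset_boundary he.primitive heb)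
  exact hb.mono_right hfb

lemma exists_crossWidth_pos (hT : IsTriangulation Ω T) (he : IsEdge Ω s(p, q))
    (hn : s(p, q) ∉ T) : ∃ f ∈ T, 0 < crossWidth p q f := by
  obtain ⟨a, b, c, ht, hm⟩ := hT.exists_mid_eq he
  have hcross : ¬ Disjoint (openSeg s(p, q)) (openSeg s(a, b)) :=
    Set.not_disjoint_iff.2 ⟨_, mid_mem _, hm ▸ mid_mem _⟩
  obtain ⟨a', b', hab, ha, hb⟩ := hT.exists_area_pos_neg he.primitive hn ht.mem_ab hcross
  refine ⟨_, ht.mem_ab, ?_⟩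
  rw [hab] at hcross ⊢
  rw [crossWidth_of_not_disjoint hcross]
  exact abs_pos.2 (by omega)

/-- A widest edge of `T` across `pq` can be flipped. -/
lemma exists_applies_crossWidth_lt (hT : IsTriangulation Ω T) (he : IsEdge Ω s(p, q))
    (hn : s(p, q) ∉ T) : ∃ f : Flip, f.Applies Ω T ∧
      ¬ Disjoint (openSeg s(p, q)) (openSeg f.removed) ∧
      crossWidth p q f.added < crossWidth p q f.removed := by
  obtain ⟨f₀, hf₀, hpos⟩ := hT.exists_crossWidth_pos he hn
  obtain ⟨f, hf, hmax⟩ := T.exists_max_image (crossWidth p q) ⟨f₀, hf₀⟩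
  have hcross := not_disjoint_of_crossWidth_pos (hpos.trans_le (hmax _ hf₀))
  have hdisj := hT.disjoint_boundary_of_not_disjoint he hn hf hcross
  obtain ⟨a, c, rfl, ha, hc⟩ := hT.exists_area_pos_neg he.primitive hn hf hcross
  have between {z} (h : |area a c z| = 1) (hcz : s(c, z) ∈ T) (hza : s(z, a) ∈ T) :
      area p q c < area p q z ∧ area p q z < area p q a :=
    area_between_of_crossWidth_le he.primitive h hcross ha hc
      (hmax _ (Sym2.eq_swap (a := c) ▸ hcz)) (hmax _ hza)
  obtain ⟨d, hd⟩ := hT.exists_tile hf hdisj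
  have hswap : s(a, c) = s(c, a) := Sym2.eq_swap
  obtain ⟨b, hb⟩ := hT.exists_tile (hswap ▸ hf) (hswap ▸ hdisj)
  obtain ⟨hcd, hda⟩ := between (by rw [hd.area_eq, abs_one]) hd.mem_bc hd.mem_ca
  obtain ⟨hcb, hba⟩ := between (by rw [area_swap, hb.area_eq, abs_neg, abs_one])
    (Sym2.eq_swap (a := b) ▸ hb.mem_ca) (Sym2.eq_swap (a := a) ▸ hb.mem_bc)
  have hp := isParallelogram_of_area_between hd.area_eq hb.area_eq ⟨hcd, hda⟩ ⟨hcb, hba⟩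
  refine ⟨⟨s(a, c), s(b, d)⟩, Flip.applies_of_isTilePair ⟨hp, hb.rotate, hd⟩ hdisj, hcross,
    (crossWidth_le p q b d).trans_lt ?_⟩
  rw [crossWidth_of_not_disjoint hcross, abs_of_pos (a := _ - area p q c) (by omega), abs_lt]
  constructor <;> omega

lemma exists_insert_subset (hT : IsTriangulation Ω T) (hET : E ⊆ T) (he : IsEdge Ω e)
    (hcross : ∀ g ∈ E, g ≠ e → Disjoint (openSeg e) (openSeg g)) :
    ∃ T', IsTriangulation Ω T' ∧ insert e E ⊆ T' := by
  induction e with | h p q =>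
  induction hN : (∑ f ∈ T, crossWidth p q f).toNat using Nat.strong_induction_on generalizing T with
  | _ N ih =>
  by_cases hn : s(p, q) ∈ T
  · exact ⟨T, hT, Finset.insert_subset hn hET⟩
  obtain ⟨f, hf, hfc, hlt⟩ := hT.exists_applies_crossWidth_lt he hn
  have hsum := hf.sum_perform hT (crossWidth p q)
  have hnonneg : 0 ≤ ∑ e ∈ f.perform T, crossWidth p q e :=
    Finset.sum_nonneg fun e _ => crossWidth_nonneg p q e
  refine ih _ (by omega) (hf.isTriangulation_perform hT) (fun g hg => ?_) rfl
  have hne : g ≠ f.removed := by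
    rintro rfl
    exact hfc (hcross _ hg fun h => hn (h ▸ hET hg))
  exact Finset.mem_insert_of_mem (Finset.mem_erase.2 ⟨hne, hET hg⟩)

lemma exists_superset (hT : IsTriangulation Ω T) (hE : IsConstraintSet Ω E) :
    ∃ T', IsTriangulation Ω T' ∧ E ⊆ T' := by
  induction E using Finset.induction_on with
  | empty => exact ⟨T, hT, Finset.empty_subset _⟩
  | insert e E _ ih =>
    obtain ⟨T₁, hT₁, hE₁⟩ := ih
      ⟨fun g hg => hE.isEdge g (Finset.mem_insert_of_mem hg), fun g hg h hh =>
        hE.nonCrossing g (Finset.mem_insert_of_mem hg) h (Finset.mem_insert_of_mem hh)⟩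
    exact hT₁.exists_insert_subset hE₁ (hE.isEdge e (Finset.mem_insert_self _ _)) fun g hg hne =>
      hE.nonCrossing e (Finset.mem_insert_self _ _) g (Finset.mem_insert_of_mem hg) hne.symm

end IsTriangulation

end Crossing

/-! ### Flip paths -/

section FlipPaths

variable {f : Flip} {K L : List Flip} {e : Sym2 LatticePoint}

lemma FlipPath.source (h : FlipPath Ω T L T') : IsTriangulation Ω T := by
  cases h with
  | nil _ h => exact h
  | cons _ _ _ _ _ h _ => exact h.source

lemma FlipPath.target (h : FlipPath Ω T L T') : IsTriangulation Ω T' := by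
  induction h with
  | nil _ h => exact h
  | cons _ _ _ _ _ _ _ ih => exact ih

@[simp] lemma flipPath_nil : FlipPath Ω T [] T' ↔ IsTriangulation Ω T ∧ T' = T := by
  constructor
  · rintro ⟨⟩
    exact ⟨‹_›, rfl⟩
  · rintro ⟨hT, rfl⟩
    exact .nil _ hT

lemma flipPath_cons :
    FlipPath Ω T (f :: L) T' ↔
      IsTriangulation Ω T ∧ f.Applies Ω T ∧ FlipPath Ω (f.perform T) L T' := by
  constructor
  · rintro (- | ⟨_, _, _, _, _, hf, hL⟩)
    exact ⟨hf.source, hf.applies, hf.eq_perform ▸ hL⟩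
  · rintro ⟨hT, hf, hL⟩
    exact .cons _ _ _ _ _ (hf.isFlip hT) hL

lemma flipPath_append :
    FlipPath Ω T (K ++ L) T' ↔ ∃ S, FlipPath Ω T K S ∧ FlipPath Ω S L T' := by
  induction K generalizing T with
  | nil =>
    simp only [List.nil_append, flipPath_nil]
    exact ⟨fun h => ⟨T, ⟨h.source, rfl⟩, h⟩, fun ⟨_, ⟨_, hS⟩, h⟩ => hS ▸ h⟩
  | cons f K ih => simp only [List.cons_append, flipPath_cons, ih, ← exists_and_left, and_assoc]

lemma flipPath_concat :
    FlipPath Ω T (K ++ [f]) T' ↔ ∃ S, FlipPath Ω T K S ∧ f.Applies Ω S ∧ T' = f.perform S := by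
  simp only [flipPath_append, flipPath_cons, flipPath_nil]
  exact exists_congr fun S => ⟨fun ⟨hS, _, hf, _, h⟩ => ⟨hS, hf, h⟩,
    fun ⟨hS, hf, h⟩ => ⟨hS, hS.target, hf, hf.isTriangulation_perform hS.target, h⟩⟩

lemma FlipPath.exists_applies (h : FlipPath Ω T (K ++ f :: L) T') :
    ∃ S, FlipPath Ω T K S ∧ f.Applies Ω S := by
  obtain ⟨S, hS, hL⟩ := flipPath_append.1 h
  exact ⟨S, hS, (flipPath_cons.1 hL).2.1⟩

namespace Flip

@[simp] lemma mem_perform : e ∈ f.perform T ↔ e = f.added ∨ e ≠ f.removed ∧ e ∈ T := by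
  simp [perform]

lemma Applies.val_perform (h : f.Applies Ω T) (hT : IsTriangulation Ω T) :
    (f.perform T).val + {f.removed} = T.val + {f.added} := by
  simpa only [Finset.sum_multiset_singleton] using h.sum_perform hT
    fun e => ({e} : Multiset (Sym2 LatticePoint))

end Flip

/-- As multisets, both sides count the edges at the end and the removed edges: an edge may be
removed and added again on the way. -/
lemma FlipPath.val_add_removed (h : FlipPath Ω T L T') :
    T'.val + ↑(L.map Flip.removed) = T.val + ↑(L.map Flip.added) := by
  induction L generalizing T with
  | nil => simp [(flipPath_nil.1 h).2]
  | cons f L ih =>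
    obtain ⟨hT, hf, hL⟩ := flipPath_cons.1 h
    simp only [List.map_cons, ← Multiset.cons_coe, ← Multiset.singleton_add]
    rw [add_left_comm, ih hL, ← add_assoc, add_comm _ (f.perform T).val,
      hf.val_perform hT, add_assoc]

namespace FlipPath

lemma target_unique {T'' : Finset (Sym2 LatticePoint)} (h : FlipPath Ω T K T')
    (h' : FlipPath Ω T L T'') (hperm : K.Perm L) : T' = T'' := by
  refine Finset.val_injective (add_right_cancel (h.val_add_removed.trans ?_))
  rw [Multiset.coe_eq_coe.2 (hperm.map _), Multiset.coe_eq_coe.2 (hperm.map Flip.removed),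
    h'.val_add_removed]

lemma mem_or_exists_added_eq (h : FlipPath Ω T L T') (he : e ∈ T') :
    e ∈ T ∨ ∃ f ∈ L, f.added = e := by
  have hmem : e ∈ T'.val + ↑(L.map Flip.removed) := Multiset.mem_add.2 (.inl he)
  simpa [h.val_add_removed] using hmem

lemma mem_of_forall_removed_ne (h : FlipPath Ω T L T') (he : e ∈ T ∨ ∃ f ∈ L, f.added = e)
    (hne : ∀ f ∈ L, f.removed ≠ e) : e ∈ T' := by
  have hmem : e ∈ T'.val + ↑(L.map Flip.removed) := by simpa [h.val_add_removed] using he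
  refine (Multiset.mem_add.1 hmem).resolve_right fun hrem => ?_
  obtain ⟨f, hf, hfe⟩ := List.mem_map.1 (Multiset.mem_coe.1 hrem)
  exact hne f hf hfe

lemma sum_map_removed {M : Type*} [AddCommMonoid M] (h : FlipPath Ω T L T')
    (φ : Sym2 LatticePoint → M) : ∑ e ∈ T', φ e + (L.map fun f => φ f.removed).sum =
      ∑ e ∈ T, φ e + (L.map fun f => φ f.added).sum := by
  have hsum := congrArg (fun s => (s.map φ).sum) h.val_add_removed
  simp only [Multiset.map_add, Multiset.sum_add, Multiset.map_coe, Multiset.sum_coe,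
    List.map_map] at hsum
  exact hsum

end FlipPath

end FlipPaths

/-! ### Flip paths that lengthen edges -/

section LengtheningPaths

variable {f : Flip} {L : List Flip} {e : Sym2 LatticePoint}

lemma Flip.IsUnimodular.isPrimitive_removed (h : f.IsUnimodular) : IsPrimitive f.removed := by
  obtain ⟨a, b, c, d, h, rfl⟩ := h
  exact isPrimitive_of_area_eq_one (c := d) (by rw [← area_rotate, h.rotate.rotate.area_eq])

lemma Flip.IsUnimodular.mid_eq (h : f.IsUnimodular) : mid f.removed = mid f.added := by
  obtain ⟨a, b, c, d, h, rfl⟩ := h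
  exact h.mid_eq

lemma Flip.Lengthens.sqLen_added_ne (h : f.Lengthens) : sqLen f.added ≠ 1 := by
  have := h.isUnimodular.isPrimitive_removed.sqLen_pos
  have := h.sqLen_lt
  omega

lemma exists_flipPath_lengthens (hT₀ : IsTriangulation Ω T₀) (hu : ∀ e ∈ T₀, sqLen e = 1) (T)
    (hT : IsTriangulation Ω T) : ∃ L, FlipPath Ω T₀ L T ∧ ∀ f ∈ L, f.Lengthens := by
  induction hN : (∑ e ∈ T, sqLen e).toNat using Nat.strong_induction_on generalizing T with
  | _ N ih =>
  by_cases h : ∃ e ∈ T, sqLen e ≠ 1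
  · obtain ⟨f, hf, hlen⟩ := hT.exists_applies_lengthens_symm hT₀ hu h
    have hsum := hf.sum_perform hT sqLen
    have hlt : sqLen f.added < sqLen f.removed := hlen.sqLen_lt
    have hnonneg := Finset.sum_nonneg fun e (_ : e ∈ f.perform T) => sqLen_nonneg e
    obtain ⟨L, hL, hLlen⟩ := ih _ (by omega) (f.perform T) (hf.isTriangulation_perform hT) rfl
    refine ⟨L ++ [f.symm], flipPath_concat.2 ⟨_, hL, hf.symm hT, (hf.symm_perform hT).symm⟩, ?_⟩
    simpa [or_imp, forall_and] using ⟨hLlen, hlen⟩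
  · push Not at h
    obtain rfl : T₀ = T := (hT₀.subset_of_sqLen_eq_one hT hu h).antisymm
      (hT.subset_of_sqLen_eq_one hT₀ h hu)
    exact ⟨[], by simpa using hT⟩

open Classical in
lemma IsTriangulation.sum_sqLen_of_mid_eq (hT : IsTriangulation Ω T) (he : e ∈ T) :
    ∑ g ∈ T, (if mid g = mid e then sqLen g else 0) = sqLen e := by
  rw [Finset.sum_eq_single_of_mem e he, if_pos rfl]
  intro g hg hne
  exact if_neg fun h => hne (hT.isDrawing.eq_of_mid_eq hg he h)

namespace FlipPath

open Classical in
lemma sum_sqLen_of_mid_eq_le (h : FlipPath Ω T L T') (hlen : ∀ f ∈ L, f.Lengthens) (z : ℂ) :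
    ∑ e ∈ T, (if mid e = z then sqLen e else 0) ≤
      ∑ e ∈ T', (if mid e = z then sqLen e else 0) := by
  have hsum := h.sum_map_removed fun e => if mid e = z then sqLen e else 0
  have hle : (L.map fun f => if mid f.removed = z then sqLen f.removed else 0).sum ≤
      (L.map fun f => if mid f.added = z then sqLen f.added else 0).sum := by
    refine List.sum_le_sum fun f hf => ?_
    rw [(hlen f hf).isUnimodular.mid_eq]
    split_ifs
    exacts [(hlen f hf).sqLen_lt.le, le_rfl]
  linarith

/-- The edge through a given midpoint never gets shorter, so a flip that lengthens it cannot be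
repeated. -/
lemma nodup (h : FlipPath Ω T L T') (hlen : ∀ f ∈ L, f.Lengthens) : L.Nodup := by
  induction L generalizing T with
  | nil => exact List.nodup_nil
  | cons f L ih =>
    obtain ⟨hT, hf, hL⟩ := flipPath_cons.1 h
    rw [List.forall_mem_cons] at hlen
    refine List.nodup_cons.2 ⟨fun hmem => ?_, ih hL hlen.2⟩
    obtain ⟨K, M, rfl⟩ := List.append_of_mem hmem
    obtain ⟨S, hS, hfS⟩ := hL.exists_applies
    have hle := hS.sum_sqLen_of_mid_eq_le (fun g hg => hlen.2 g (by simp [hg])) (mid f.added)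
    rw [hL.source.sum_sqLen_of_mid_eq (Flip.mem_perform.2 (.inl rfl)),
      ← hlen.1.isUnimodular.mid_eq, hS.target.sum_sqLen_of_mid_eq hfS.removed_mem] at hle
    exact hle.not_gt hlen.1.sqLen_lt

/-- No edge appears twice among the initial edges and the added ones, because the longer diagonal
determines a lengthening flip. -/
lemma removed_ne (h : FlipPath Ω T L T') (hu : ∀ e ∈ T, sqLen e = 1)
    (hlen : ∀ f ∈ L, f.Lengthens) (hnd : L.Nodup) (he : e ∈ T') (hf : f ∈ L) :
    f.removed ≠ e := by
  have hadded : (L.map Flip.added).Nodup :=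
    hnd.map_on fun f hf g hg h => (hlen f hf).eq_of_added_eq (hlen g hg) h
  have hnodup : (T'.val + ↑(L.map Flip.removed)).Nodup := by
    rw [h.val_add_removed, Multiset.nodup_add]
    refine ⟨T.nodup, hadded, Multiset.disjoint_left.2 fun {e} heT hemem => ?_⟩
    obtain ⟨f, hf, rfl⟩ := List.mem_map.1 (Multiset.mem_coe.1 hemem)
    exact (hlen f hf).sqLen_added_ne (hu _ heT)
  rintro rfl
  exact Multiset.disjoint_left.1 (Multiset.nodup_add.1 hnodup).2.2 he
    (Multiset.mem_coe.2 (List.mem_map_of_mem hf))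

end FlipPath

end LengtheningPaths

/-! ### The flips required to generate a set of edges -/

section Required

variable {f g : Flip} {L : List Flip} {e : Sym2 LatticePoint}
  {E' : Finset (Sym2 LatticePoint)}

namespace Flip

/-- The edges that a triangulation must contain for `f` to be applicable: the removed diagonal and
the sides of its parallelogram. -/
def required (f : Flip) : Set (Sym2 LatticePoint) := insert f.removed f.sides

lemma Applies.required_subset (h : f.Applies Ω T) : f.required ⊆ T :=
  Set.insert_subset h.removed_mem h.sides_subset

lemma Applies.of_required_subset (h : f.Applies Ω T) (hreq : f.required ⊆ T') : f.Applies Ω T' :=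
  ⟨h.isUnimodular, hreq (Set.mem_insert ..), (Set.subset_insert ..).trans hreq,
    h.disjoint_boundary⟩

end Flip

/-- The edges that must appear in the course of generating `E` from unit edges. The only way to
generate a longer edge from shorter ones is the lengthening flip that adds it. -/
inductive Needed (E : Finset (Sym2 LatticePoint)) : Sym2 LatticePoint → Prop
  | of_mem {e : Sym2 LatticePoint} : e ∈ E → Needed E e
  | of_required {f : Flip} {e : Sym2 LatticePoint} :
      f.Lengthens → Needed E f.added → e ∈ f.required → Needed E e

namespace Needed

lemma mono (hE : E ⊆ E') (h : Needed E e) : Needed E' e := by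
  induction h with
  | of_mem he => exact .of_mem (hE he)
  | of_required hf _ he ih => exact .of_required hf ih he

lemma mem_of_sqLen_eq_one (hu : ∀ e ∈ T, sqLen e = 1) (h : Needed T e) : e ∈ T := by
  induction h with
  | of_mem he => exact he
  | of_required hf _ _ ih => exact absurd (hu _ ih) hf.sqLen_added_ne

lemma of_perform (hg : g.Applies Ω T) (h : Needed (g.perform T) e) :
    Needed T e ∨ g.Lengthens ∧ g.added = e := by
  induction h with
  | of_mem he =>
    rcases Flip.mem_perform.1 he with rfl | ⟨-, he⟩
    · rcases hg.isUnimodular.lengthens_or with h | h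
      · exact .inr ⟨h, rfl⟩
      · exact .inl (.of_required h (.of_mem hg.removed_mem) (Set.mem_insert ..))
    · exact .inl (.of_mem he)
  | of_required hf _ hreq ih =>
    rcases ih with h | ⟨h, he⟩
    · exact .inl (.of_required hf h hreq)
    · obtain rfl := h.eq_of_added_eq hf he
      exact .inl (.of_mem (hg.required_subset hreq))

end Needed

namespace FlipPath

lemma mem_of_needed (h : FlipPath Ω T₀ L T) (hu : ∀ e ∈ T₀, sqLen e = 1) (hf : f.Lengthens)
    (hn : Needed T f.added) : f ∈ L := by
  induction L using List.reverseRecOn generalizing T with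
  | nil =>
    obtain rfl := (flipPath_nil.1 h).2
    exact absurd (hu _ (hn.mem_of_sqLen_eq_one hu)) hf.sqLen_added_ne
  | append_singleton K g ih =>
    obtain ⟨S, hS, hg, rfl⟩ := flipPath_concat.1 h
    rw [List.mem_append, List.mem_singleton]
    exact (hn.of_perform hg).imp (ih hS) fun ⟨hg, he⟩ => hf.eq_of_added_eq hg he.symm

open Classical in
/-- The flips that add unneeded edges can be left out: the remaining ones never use such an edge. -/
lemma filter_needed (E : Finset (Sym2 LatticePoint)) (h : FlipPath Ω T₀ L T)
    (hlen : ∀ f ∈ L, f.Lengthens) :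
    ∃ S, FlipPath Ω T₀ (L.filter fun f => Needed E f.added) S ∧
      (∀ e ∈ T, Needed E e → e ∈ S) ∧ totalLength S ≤ totalLength T := by
  induction L using List.reverseRecOn generalizing T with
  | nil => exact ⟨T, h, fun e he _ => he, le_rfl⟩
  | append_singleton K g ih =>
    obtain ⟨T₁, hT₁, hg, rfl⟩ := flipPath_concat.1 h
    obtain ⟨S, hS, hTS, hle⟩ := ih hT₁ fun f hf => hlen f (by simp [hf])
    have hglen := hlen g (by simp)
    have hsum := hg.sum_perform hT₁.target edgeLength
    unfold totalLength at hle ⊢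
    rw [List.filter_append]
    by_cases hn : Needed E g.added
    · have hgS : g.Applies Ω S := hg.of_required_subset fun e he =>
        hTS e (hg.required_subset he) (.of_required hglen hn he)
      have hsumS := hgS.sum_perform hS.target edgeLength
      rw [List.filter_singleton, decide_eq_true hn]
      refine ⟨g.perform S, flipPath_concat.2 ⟨S, hS, hgS, rfl⟩, fun e he hne => ?_, by linarith⟩
      exact Flip.mem_perform.2 ((Flip.mem_perform.1 he).imp_right fun h => ⟨h.1, hTS e h.2 hne⟩)
    · rw [List.filter_singleton, decide_eq_false hn]
      refine ⟨S, by simpa using hS, fun e he hne => ?_, ?_⟩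
      · rcases Flip.mem_perform.1 he with rfl | ⟨-, he⟩
        · exact absurd hne hn
        · exact hTS e he hne
      · linarith [edgeLength_lt_iff.2 hglen.sqLen_lt]

end FlipPath

end Required

/-! ### Linear orderings -/

instance : DecidableEq Flip := fun f g =>
  decidable_of_iff (f.removed = g.removed ∧ f.added = g.added) Flip.ext_iff.symm

namespace FlipPoset

variable {π : FlipPoset} {f g : Flip} {L : List Flip}

lemma IsLinearOrdering.idxOf_le (hL : π.IsLinearOrdering L) (h : π.le f g) :
    L.idxOf f ≤ L.idxOf g := by
  obtain ⟨hf, hg⟩ := π.mem_of_le f g h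
  have hf' := List.idxOf_lt_length_of_mem ((hL.1.2 f).2 hf)
  have hg' := List.idxOf_lt_length_of_mem ((hL.1.2 g).2 hg)
  by_contra! hlt
  have hnot := List.pairwise_iff_getElem.1 hL.2 _ _ hg' hf' hlt
  rw [List.getElem_idxOf, List.getElem_idxOf] at hnot
  exact hnot h

lemma exists_isLinearOrdering_of_key (c : Flip → ℕ) (hc : ∀ f g, π.le f g → f ≠ g → c f < c g) :
    ∃ L, π.IsLinearOrdering L ∧ L.Pairwise fun f g => c f ≤ c g := by
  let L := π.flips.toList.mergeSort fun f g => c f ≤ c g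
  have hperm : L.Perm π.flips.toList := List.mergeSort_perm ..
  have hnd : L.Nodup := hperm.nodup_iff.2 π.flips.nodup_toList
  have hsorted : L.Pairwise fun f g => c f ≤ c g := by
    simpa using List.pairwise_mergeSort (le := fun f g => decide (c f ≤ c g))
      (by simpa using fun _ _ _ => Nat.le_trans)
      (by simpa using fun f g => Nat.le_total (c f) (c g)) π.flips.toList
  refine ⟨L, ⟨⟨hnd, fun f => by rw [hperm.mem_iff, Finset.mem_toList]⟩, ?_⟩, hsorted⟩
  exact (hsorted.and hnd).imp fun ⟨hle, hne⟩ h => (hc _ _ h hne.symm).not_ge hle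

/-- The number of elements below `f` in `π`, a strictly monotone function of `f`. -/
noncomputable def height (π : FlipPoset) (f : Flip) : ℕ := {g | π.le g f}.ncard

lemma finite_setOf_le (π : FlipPoset) (f : Flip) : {g | π.le g f}.Finite :=
  π.flips.finite_toSet.subset fun g h => (π.mem_of_le g f h).1

lemma height_le_card (π : FlipPoset) (f : Flip) : π.height f ≤ π.flips.card := by
  rw [← Set.ncard_coe_finset]
  exact Set.ncard_le_ncard (fun g h => (π.mem_of_le g f h).1) π.flips.finite_toSet

lemma height_pos (hf : f ∈ π.flips) : 0 < π.height f :=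
  (Set.ncard_pos (π.finite_setOf_le f)).2 ⟨f, π.le_refl f hf⟩

lemma height_lt_height (h : π.le f g) (hne : f ≠ g) : π.height f < π.height g :=
  Set.ncard_lt_ncard ⟨fun _ hx => π.le_trans _ _ _ hx h,
    fun hsub => hne (π.le_antisymm _ _ h (hsub (π.le_refl g (π.mem_of_le f g h).2)))⟩
    (π.finite_setOf_le g)

lemma exists_isLinearOrdering (π : FlipPoset) : ∃ L, π.IsLinearOrdering L :=
  (exists_isLinearOrdering_of_key π.height fun _ _ => height_lt_height).imp fun _ => And.left

/-- If `f` is not below `g`, some linear ordering lists all the elements below `g` before `f`. -/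
lemma le_iff_forall_idxOf_le (π : FlipPoset) (f g : Flip) : π.le f g ↔
    f ∈ π.flips ∧ g ∈ π.flips ∧ ∀ L, π.IsLinearOrdering L → L.idxOf f ≤ L.idxOf g := by
  classical
  refine ⟨fun h => ⟨(π.mem_of_le f g h).1, (π.mem_of_le f g h).2, fun L hL => hL.idxOf_le h⟩, ?_⟩
  rintro ⟨hf, hg, h⟩
  by_contra hle
  let c (x : Flip) : ℕ := π.height x + if π.le x g then 0 else π.flips.card
  have hc x y (hxy : π.le x y) (hne : x ≠ y) : c x < c y := by
    have hlt := height_lt_height hxy hne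
    have hdown : π.le y g → π.le x g := π.le_trans x y g hxy
    grind
  obtain ⟨L, hL, hsorted⟩ := exists_isLinearOrdering_of_key c hc
  have hgf : c g < c f := by
    have hcg : c g = π.height g := by simp [c, π.le_refl g hg]
    have hcf : c f = π.height f + π.flips.card := by simp [c, hle]
    have := π.height_le_card g
    have := height_pos hf
    omega
  have hfL := (hL.1.2 f).2 hf
  have hne : L.idxOf f ≠ L.idxOf g := fun heq => hle ((List.idxOf_inj hfL).1 heq ▸ π.le_refl f hf)
  have hcfg := List.pairwise_iff_getElem.1 hsorted _ _ (List.idxOf_lt_length_of_mem hfL)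
    (List.idxOf_lt_length_of_mem ((hL.1.2 g).2 hg)) ((h L hL).lt_of_ne hne)
  rw [List.getElem_idxOf, List.getElem_idxOf] at hcfg
  exact hcfg.not_gt hgf

end FlipPoset

/-! ### The flip plan -/

section Plan

variable {f g : Flip} {L : List Flip} {e : Sym2 LatticePoint}

/-- The lengthening flips that every flip path from unit edges that generates `E` must contain, see
`Generates.mem`. -/
def requiredFlips (E : Finset (Sym2 LatticePoint)) : Set Flip :=
  {f | f.Lengthens ∧ Needed E f.added}

lemma Generates.mem (h : Generates Ω T₀ E L) (hu : ∀ e ∈ T₀, sqLen e = 1)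
    (hf : f ∈ requiredFlips E) : f ∈ L := by
  obtain ⟨T, hL, hET⟩ := h
  exact hL.mem_of_needed hu hf.1 (hf.2.mono hET)

/-- `L` is a flip path from `T₀` that generates `E` and consists of the flips required by `E`, once
each. -/
structure IsPathListing (Ω : Polygon ℂ n) (T₀ E : Finset (Sym2 LatticePoint)) (L : List Flip) :
    Prop where
  nodup : L.Nodup
  mem_iff : ∀ f, f ∈ L ↔ f ∈ requiredFlips E
  generates : Generates Ω T₀ E L

lemma IsTriangulation.exists_isPathListing (hT : IsTriangulation Ω T)
    (hT₀ : IsTriangulation Ω T₀) (hu : ∀ e ∈ T₀, sqLen e = 1) (hET : E ⊆ T) :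
    ∃ L S, IsPathListing Ω T₀ E L ∧ FlipPath Ω T₀ L S ∧ E ⊆ S ∧
      totalLength S ≤ totalLength T := by
  classical
  obtain ⟨L, hL, hlen⟩ := exists_flipPath_lengthens hT₀ hu T hT
  obtain ⟨S, hS, hsub, hle⟩ := hL.filter_needed E hlen
  have hES : E ⊆ S := fun e he => hsub e (hET he) (.of_mem he)
  refine ⟨_, S, ⟨(hL.nodup hlen).filter _, fun f => ?_, S, hS, hES⟩, hS, hES, hle⟩
  rw [List.mem_filter, decide_eq_true_iff]
  exact ⟨fun h => ⟨hlen f h.1, h.2⟩, fun h => ⟨Generates.mem ⟨T, hL, hET⟩ hu h, h.2⟩⟩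

namespace IsPathListing

variable {L' : List Flip}

lemma finite_requiredFlips (h : IsPathListing Ω T₀ E L) : (requiredFlips E).Finite :=
  L.finite_toSet.subset fun f hf => (h.mem_iff f).2 hf

lemma perm (h : IsPathListing Ω T₀ E L) (h' : IsPathListing Ω T₀ E L') : L.Perm L' :=
  (List.perm_ext_iff_of_nodup h.nodup h'.nodup).2 fun f => (h.mem_iff f).trans (h'.mem_iff f).symm

lemma exists_applies (h : IsPathListing Ω T₀ E L) (hg : g ∈ requiredFlips E) :
    ∃ S, FlipPath Ω T₀ (L.take (L.idxOf g)) S ∧ g.Applies Ω S := by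
  obtain ⟨T, hT, -⟩ := h.generates
  have hlt := List.idxOf_lt_length_of_mem ((h.mem_iff g).2 hg)
  rw [← List.take_append_drop (L.idxOf g) L, List.drop_eq_getElem_cons hlt,
    List.getElem_idxOf] at hT
  exact hT.exists_applies

lemma mem_or_exists_idxOf_lt (h : IsPathListing Ω T₀ E L) (hg : g ∈ requiredFlips E)
    (he : e ∈ g.required) :
    e ∈ T₀ ∨ ∃ f ∈ requiredFlips E, f.added = e ∧ L.idxOf f < L.idxOf g := by
  obtain ⟨S, hS, hgS⟩ := h.exists_applies hg
  refine (hS.mem_or_exists_added_eq (hgS.required_subset he)).imp_right fun ⟨f, hf, hfe⟩ => ?_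
  have hfL := List.mem_of_mem_take hf
  exact ⟨f, (h.mem_iff f).1 hfL, hfe, (List.mem_take_iff_idxOf_lt hfL).1 hf⟩

lemma idxOf_lt_of_added_mem (h : IsPathListing Ω T₀ E L) (hu : ∀ e ∈ T₀, sqLen e = 1)
    (hf : f ∈ requiredFlips E) (hg : g ∈ requiredFlips E) (hfg : f.added ∈ g.required) :
    L.idxOf f < L.idxOf g := by
  rcases h.mem_or_exists_idxOf_lt hg hfg with hmem | ⟨f', hf', heq, hlt⟩
  · exact absurd (hu _ hmem) hf.1.sqLen_added_ne
  · rwa [hf'.1.eq_of_added_eq hf.1 heq] at hlt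

lemma idxOf_le_of_removed_mem (h : IsPathListing Ω T₀ E L) (hu : ∀ e ∈ T₀, sqLen e = 1)
    (hf : f ∈ requiredFlips E) (hg : g ∈ requiredFlips E) (hfg : f.removed ∈ g.required) :
    L.idxOf g ≤ L.idxOf f := by
  obtain ⟨S, hS, hgS⟩ := h.exists_applies hg
  by_contra! hlt
  exact hS.removed_ne hu (fun k hk => ((h.mem_iff k).1 (List.mem_of_mem_take hk)).1)
    (h.nodup.sublist (List.take_sublist ..)) (hgS.required_subset hfg)
    ((List.mem_take_iff_idxOf_lt ((h.mem_iff f).2 hf)).2 hlt) rfl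

end IsPathListing

/-- The flips required by `E`, ordered by precedence in all the flip paths from `T₀` that generate
`E` and list them. -/
noncomputable def flipPlan (Ω : Polygon ℂ n) (T₀ E : Finset (Sym2 LatticePoint))
    (hne : ∃ L, IsPathListing Ω T₀ E L) : FlipPoset where
  flips := (hne.elim fun _ h => h.finite_requiredFlips).toFinset
  le f g := f ∈ requiredFlips E ∧ g ∈ requiredFlips E ∧
    ∀ L, IsPathListing Ω T₀ E L → L.idxOf f ≤ L.idxOf g
  mem_of_le f g h := by simpa using ⟨h.1, h.2.1⟩
  le_refl f hf := by simpa using hf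
  le_trans f g h h1 h2 := ⟨h1.1, h2.2.1, fun L hL => (h1.2.2 L hL).trans (h2.2.2 L hL)⟩
  le_antisymm f g h1 h2 := by
    obtain ⟨L, hL⟩ := hne
    exact (List.idxOf_inj ((hL.mem_iff f).2 h1.1)).1 ((h1.2.2 L hL).antisymm (h2.2.2 L hL))

section FlipPlan

variable (hne : ∃ L, IsPathListing Ω T₀ E L)

lemma mem_flips_flipPlan : f ∈ (flipPlan Ω T₀ E hne).flips ↔ f ∈ requiredFlips E :=
  Set.Finite.mem_toFinset _

variable {hne}

/-- When the turn of `g` comes, the flips that add the edges it requires have been performed, and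
those that remove them have not. -/
lemma applies_of_isLinearOrdering {K M : List Flip} {S : Finset (Sym2 LatticePoint)}
    (hu : ∀ e ∈ T₀, sqLen e = 1) (hL : (flipPlan Ω T₀ E hne).IsLinearOrdering (K ++ g :: M))
    (hS : FlipPath Ω T₀ K S) : g.Applies Ω S := by
  obtain ⟨⟨-, hmem⟩, hpw⟩ := hL
  simp only [mem_flips_flipPlan] at hmem
  rw [List.pairwise_append, List.pairwise_cons] at hpw
  obtain ⟨-, ⟨hgM, -⟩, hKg⟩ := hpw
  have hg : g ∈ requiredFlips E := (hmem g).1 (by simp)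
  obtain ⟨L₀, hL₀⟩ := id hne
  obtain ⟨S₀, -, hgS₀⟩ := hL₀.exists_applies hg
  refine hgS₀.of_required_subset fun e he => hS.mem_of_forall_removed_ne ?_ ?_
  · refine (hL₀.mem_or_exists_idxOf_lt hg he).imp_right fun ⟨f, hf, hfe, hlt⟩ => ⟨f, ?_, hfe⟩
    have hfL := (hmem f).2 hf
    rw [List.mem_append, List.mem_cons] at hfL
    rcases hfL with hfK | rfl | hfM
    · exact hfK
    · exact absurd hlt (lt_irrefl _)
    · exact absurd ⟨hf, hg, fun L hL => (hL.idxOf_lt_of_added_mem hu hf hg (hfe ▸ he)).le⟩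
        (hgM f hfM)
  · rintro f hfK rfl
    have hf := (hmem f).1 (by simp [hfK])
    exact hKg f hfK g (by simp) ⟨hg, hf, fun L hL => hL.idxOf_le_of_removed_mem hu hf hg he⟩

lemma exists_flipPath_of_isLinearOrdering (hT₀ : IsTriangulation Ω T₀)
    (hu : ∀ e ∈ T₀, sqLen e = 1) (hL : (flipPlan Ω T₀ E hne).IsLinearOrdering L) :
    ∃ S, FlipPath Ω T₀ L S := by
  suffices ∀ K M, K ++ M = L → ∃ S, FlipPath Ω T₀ K S from this L [] (by simp)
  intro K
  induction K using List.reverseRecOn with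
  | nil => exact fun _ _ => ⟨T₀, .nil _ hT₀⟩
  | append_singleton K g ih =>
    intro M hM
    rw [List.append_assoc, List.singleton_append] at hM
    obtain ⟨S, hS⟩ := ih _ hM
    subst hM
    exact ⟨_, flipPath_concat.2 ⟨S, hS, applies_of_isLinearOrdering hu hL hS, rfl⟩⟩

lemma flipPlan_isLinearOrdering_iff (hT₀ : IsTriangulation Ω T₀) (hu : ∀ e ∈ T₀, sqLen e = 1) :
    (flipPlan Ω T₀ E hne).IsLinearOrdering L ↔ IsPathListing Ω T₀ E L := by
  constructor
  · intro hL
    obtain ⟨S, hS⟩ := exists_flipPath_of_isLinearOrdering hT₀ hu hL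
    obtain ⟨L₀, hL₀⟩ := id hne
    obtain ⟨T, hT, hET⟩ := hL₀.generates
    have hmem f : f ∈ L ↔ f ∈ requiredFlips E := (hL.1.2 f).trans (mem_flips_flipPlan hne)
    have hperm : L₀.Perm L := (List.perm_ext_iff_of_nodup hL₀.nodup hL.1.1).2 fun f =>
      (hL₀.mem_iff f).trans (hmem f).symm
    exact ⟨hL.1.1, hmem, S, hS, hT.target_unique hS hperm ▸ hET⟩
  · intro h
    refine ⟨⟨h.nodup, fun f => (h.mem_iff f).trans (mem_flips_flipPlan hne).symm⟩, ?_⟩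
    refine List.pairwise_iff_getElem.2 fun i j hi hj hij hle => ?_
    have := hle.2.2 L h
    rw [h.nodup.idxOf_getElem, h.nodup.idxOf_getElem] at this
    omega

lemma flipPlan_isMinimumFlipPlan (hT₀ : IsTriangulation Ω T₀) (hu : ∀ e ∈ T₀, sqLen e = 1) :
    (flipPlan Ω T₀ E hne).IsMinimumFlipPlan Ω T₀ E := by
  refine ⟨fun L hL => ?_, fun L hL L' hL' => ?_⟩
  · rw [flipPlan_isLinearOrdering_iff hT₀ hu]
    exact ⟨fun h => h.generates,
      fun h => ⟨hL.1, fun f => (hL.2 f).trans (mem_flips_flipPlan hne), h⟩⟩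
  · have h := (flipPlan_isLinearOrdering_iff hT₀ hu).1 hL
    exact (h.nodup.subperm fun f hf => hL'.mem hu ((h.mem_iff f).1 hf)).length_le

/-- A minimum flip plan has no room for flips other than the required ones, hence its linear
orderings, which determine it, are those of `flipPlan`. -/
lemma FlipPoset.IsMinimumFlipPlan.eq_flipPlan {π : FlipPoset} (hπ : π.IsMinimumFlipPlan Ω T₀ E)
    (hT₀ : IsTriangulation Ω T₀) (hu : ∀ e ∈ T₀, sqLen e = 1) : π = flipPlan Ω T₀ E hne := by
  obtain ⟨L, hL⟩ := π.exists_isLinearOrdering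
  obtain ⟨L₀, hL₀⟩ := id hne
  have hsub : L₀.Subperm L :=
    hL₀.nodup.subperm fun f hf => ((hπ.1 L hL.1).1 hL).mem hu ((hL₀.mem_iff f).1 hf)
  have hperm := hsub.perm_of_length_le (hπ.2 L hL L₀ hL₀.generates)
  have hflips : π.flips = (flipPlan Ω T₀ E hne).flips := by
    ext f
    rw [← hL.1.2 f, ← hperm.mem_iff, hL₀.mem_iff, mem_flips_flipPlan]
  have hlin L : π.IsLinearOrdering L ↔ (flipPlan Ω T₀ E hne).IsLinearOrdering L := by
    have hlist : π.IsListing L ↔ (flipPlan Ω T₀ E hne).IsListing L := by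
      rw [IsListing, hflips, ← IsListing]
    constructor <;> intro h
    · exact ((flipPlan_isMinimumFlipPlan hT₀ hu).1 L (hlist.1 h.1)).2 ((hπ.1 L h.1).1 h)
    · exact (hπ.1 L (hlist.2 h.1)).2
        (((flipPlan_isMinimumFlipPlan hT₀ hu).1 L h.1).1 h)
  refine FlipPoset.ext hflips (funext₂ fun f g => propext ?_)
  rw [π.le_iff_forall_idxOf_le, FlipPoset.le_iff_forall_idxOf_le]
  simp only [hflips, hlin]

end FlipPlan

end Plan

end LatticeFlip

theorem mainTheorem7_general {n : ℕ} (Ω : Polygon ℂ n)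
    (T₀ : Finset (Sym2 LatticePoint)) (hT₀ : IsEquilateralTriangulation Ω T₀)
    (E : Finset (Sym2 LatticePoint)) (hE : IsConstraintSet Ω E) :
    (∃! π : FlipPoset, π.IsMinimumFlipPlan Ω T₀ E) ∧
      ∀ π : FlipPoset, π.IsMinimumFlipPlan Ω T₀ E →
        ∃ T : Finset (Sym2 LatticePoint), π.Yields Ω T₀ T ∧ IsMinimumTriangulation Ω E T := by
  have hu := hT₀.sqLen_eq_one
  replace hT₀ := hT₀.1
  obtain ⟨T, hT, hET⟩ := hT₀.exists_superset hE
  obtain ⟨L, S, hL, hS, hES, -⟩ := hT.exists_isPathListing hT₀ hu hET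
  refine ⟨⟨flipPlan Ω T₀ E ⟨L, hL⟩, flipPlan_isMinimumFlipPlan hT₀ hu,
    fun π hπ => hπ.eq_flipPlan hT₀ hu⟩, fun π hπ => ⟨S, fun L' hL' => ?_, hS.target, hES, ?_⟩⟩
  · rw [hπ.eq_flipPlan (hne := ⟨L, hL⟩) hT₀ hu, flipPlan_isLinearOrdering_iff hT₀ hu] at hL'
    obtain ⟨S', hS', -⟩ := hL'.generates
    rwa [hS.target_unique hS' (hL.perm hL')]
  · intro T' hT' hET'
    obtain ⟨L', S', hL', hS', -, hle⟩ := hT'.exists_isPathListing hT₀ hu hET'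
    rwa [hS.target_unique hS' (hL.perm hL')]

theorem mainTheorem7 {n : ℕ} (Ω : Polygon ℂ n) (hΩ : IsSimpleLatticePolygon Ω)
    (T₀ : Finset (Sym2 LatticePoint)) (hT₀ : IsEquilateralTriangulation Ω T₀)
    (E : Finset (Sym2 LatticePoint)) (hE : IsConstraintSet Ω E) :
    (∃! π : FlipPoset, π.IsMinimumFlipPlan Ω T₀ E) ∧
      ∀ π : FlipPoset, π.IsMinimumFlipPlan Ω T₀ E →
        ∃ T : Finset (Sym2 LatticePoint), π.Yields Ω T₀ T ∧ IsMinimumTriangulation Ω E T :=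
  mainTheorem7_general Ω T₀ hT₀ E hE
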